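/- Write $2^{<\omega}$ for the set of finite binary strings, $2^\omega$ for Cantor space, $\preceq$ for the initial-segment relation, and $\lambda$ for the uniform (Lebesgue) measure on $2^\omega$. For $U\subseteq 2^{<\omega}$ let $[\![U]\!]$ be the set of all $X\in 2^\omega$ that have an initial segment in $U$. A Turing functional $\Phi$ is a c.e. set of pairs $(\sigma,\tau)\in 2^{<\omega}\times 2^{<\omega}$ such that whenever $(\sigma,\tau),(\sigma',\tau')\in\Phi$ and $\sigma\preceq\sigma'$, then $\tau\preceq\tau'$ or $\tau'\preceq\tau$. For $X\in 2^\omega$ let $\Phi^X$ be the shortest (finite or infinite) binary sequence that extends every $\tau$ for which there is $\sigma\preceq X$ with $(\sigma,\tau)\in\Phi$. Put $\mathrm{dom}(\Phi)=\{X\in 2^\omega:\Phi^X\in 2^\omega\}$, and write $\Phi(X)=\Phi^X$ for $X\in\mathrm{dom}(\Phi)$. The semi-measure induced by $\Phi$ is the function $\lambda_\Phi(\sigma)=\lambda(\{X\in 2^\omega:\Phi^X\succeq\sigma\})$ on $2^{<\omega}$. A sequence $X\in 2^\omega$ is 2-random, $X\in\mathsf{2MLR}$, if $X\notin\bigcap_i[\![U_i]\!]$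 for every sequence $(U_i)_{i\in\omega}$ of subsets of $2^{<\omega}$ that is uniformly c.e. relative to the halting problem $\emptyset'$ and satisfies $\lambda([\![U_i]\!])\le 2^{-i}$ for all $i$. For $\mathcal A\subseteq 2^\omega$ let $\Phi(\mathcal A)=\{\Phi(X):X\in\mathcal A\cap\mathrm{dom}(\Phi)\}$. **Corollary.** If $\Phi$ and $\Psi$ are Turing functionals such that $\lambda_\Phi=\lambda_\Psi$, then $\Phi(\mathsf{2MLR})=\Psi(\mathsf{2MLR})$. In other words, Shen's question (whether the semi-measure induced by a Turing functional determines the image of the random sequences under the functional) has a positive answer for 2-randomness. -/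

import Mathlib

namespace Shen

open MeasureTheory
open scoped ENNReal

/-- Cantor space `2^ω`; it carries the product topology and the product `σ`-algebra. -/
abbrev CantorSeq : Type := ℕ → Bool

/-- The string `X ↾ n` of the first `n` bits of `X`. -/
def firstBits (X : CantorSeq) (n : ℕ) : List Bool := (List.range n).map X

/-- `σ ≺ X`: the string `σ` is an initial segment of the sequence `X`. -/
def IsInitial (σ : List Bool) (X : CantorSeq) : Prop := firstBits X σ.length = σ

/-- `⟦S⟧`, the set of all sequences that have an initial segment in `S`. -/
def openSet (S : Set (List Bool)) : Set CantorSeq := {X | ∃ σ ∈ S, IsInitial σ X}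

/-- The uniform (Lebesgue) measure `λ` on Cantor space: the bits are independent and each of them
is `0` or `1` with probability `1/2`. -/
noncomputable def uniformMeasure : Measure CantorSeq :=
  Measure.infinitePi fun _ : ℕ => (PMF.uniformOfFintype Bool).toMeasure

/-- The uniform measure of the cylinder of `σ` is `2 ^ (-|σ|)`. -/
theorem uniformMeasure_cylinder (σ : List Bool) :
    uniformMeasure (openSet {σ}) = (2⁻¹ : ℝ≥0∞) ^ σ.length := by
  have h : openSet {σ} = Set.pi (Finset.range σ.length : Set ℕ) (fun i => {σ.getD i false}) := by
    ext X
    simp only [openSet, IsInitial, firstBits, Set.mem_ofPred_eq, Set.mem_singleton_iff,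
      exists_eq_left, Set.mem_pi, Finset.coe_range, Set.mem_Iio]
    constructor
    · intro hX i hi
      conv_rhs => rw [← hX]
      simp [List.getD, hi]
    · intro hX
      apply List.ext_getElem
      · simp
      · intro i h1 h2
        simp [hX i h2, List.getD, h2]
  rw [h, uniformMeasure, Measure.infinitePi_pi _ (fun _ _ => MeasurableSet.of_discrete)]
  simp

/-- A Turing functional: a c.e. set of pairs of strings, any two of which have comparable second
components whenever their first components are comparable. -/
structure TuringFunctional where
  /-- The pairs `(σ, τ)` of the functional. -/
  graph : Set (List Bool × List Bool)
  /-- The set of pairs is computably enumerable. -/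
  isCE : REPred fun p : List Bool × List Bool => p ∈ graph
  /-- If `(σ, τ)` and `(σ', τ')` are in the functional and `σ ⪯ σ'`, then `τ ⪯ τ'` or `τ' ⪯ τ`. -/
  consistent : ∀ σ τ σ' τ' : List Bool, (σ, τ) ∈ graph → (σ', τ') ∈ graph → σ <+: σ' →
    τ <+: τ' ∨ τ' <+: τ

namespace TuringFunctional

/-- `Φ^X ⪰ τ`, where `Φ^X` is the finite or infinite output of `Φ` on the oracle `X`: either `τ` is
the empty string, or some pair `(σ, τ')` of `Φ` satisfies `σ ≺ X` and `τ ⪯ τ'`. -/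
def OutputExtends (Φ : TuringFunctional) (X : CantorSeq) (τ : List Bool) : Prop :=
  τ = [] ∨ ∃ σ τ', (σ, τ') ∈ Φ.graph ∧ IsInitial σ X ∧ τ <+: τ'

/-- The partial map `Φ : 2^ω → 2^ω`. It is defined at `X` if the output `Φ^X` is infinite, and its
value is then the sequence all of whose initial segments are initial segments of `Φ^X`. -/
noncomputable def toPFun (Φ : TuringFunctional) : CantorSeq →. CantorSeq := fun X =>
  ⟨∃ Y : CantorSeq, ∀ n, Φ.OutputExtends X (firstBits Y n), fun h => h.choose⟩

theorem isInitial_comparable {σ σ' : List Bool} {X : CantorSeq} (h : IsInitial σ X)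
    (h' : IsInitial σ' X) : σ <+: σ' ∨ σ' <+: σ := by
  have key : ∀ a b : ℕ, a ≤ b → firstBits X a <+: firstBits X b := by
    intro a b hab
    obtain ⟨c, rfl⟩ := Nat.exists_eq_add_of_le hab
    simp [firstBits, List.range_add]
  unfold IsInitial at h h'
  rw [← h, ← h']
  rcases le_total σ.length σ'.length with hl | hl
  · exact Or.inl (key _ _ hl)
  · exact Or.inr (key _ _ hl)

theorem outputExtends_comparable (Φ : TuringFunctional) {X : CantorSeq} {τ τ' : List Bool}
    (h : Φ.OutputExtends X τ) (h' : Φ.OutputExtends X τ') : τ <+: τ' ∨ τ' <+: τ := by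
  rcases h with rfl | ⟨σ, ρ, hg, hX, hp⟩
  · exact Or.inl (List.nil_prefix)
  rcases h' with rfl | ⟨σ', ρ', hg', hX', hp'⟩
  · exact Or.inr (List.nil_prefix)
  have hc : ρ <+: ρ' ∨ ρ' <+: ρ := by
    rcases isInitial_comparable hX hX' with hs | hs
    · exact Φ.consistent _ _ _ _ hg hg' hs
    · exact (Φ.consistent _ _ _ _ hg' hg hs).symm
  rcases hc with hc | hc
  · exact List.prefix_or_prefix_of_prefix (hp.trans hc) hp'
  · exact List.prefix_or_prefix_of_prefix hp (hp'.trans hc)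

/-- `Φ(X) = Y` holds exactly if all initial segments of `Y` are initial segments of `Φ^X`. -/
theorem mem_toPFun_iff (Φ : TuringFunctional) (X Y : CantorSeq) :
    Y ∈ Φ.toPFun X ↔ ∀ n, Φ.OutputExtends X (firstBits Y n) := by
  constructor
  · rintro ⟨h, rfl⟩
    exact h.choose_spec
  · intro hY
    have hd : ∃ Z : CantorSeq, ∀ n, Φ.OutputExtends X (firstBits Z n) := ⟨Y, hY⟩
    refine ⟨hd, ?_⟩
    have hZ := hd.choose_spec
    change hd.choose = Y
    funext n
    have hlen : (firstBits hd.choose (n + 1)).length = (firstBits Y (n + 1)).length := by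
      simp [firstBits]
    have heq : firstBits hd.choose (n + 1) = firstBits Y (n + 1) := by
      rcases Φ.outputExtends_comparable (hZ (n + 1)) (hY (n + 1)) with h | h
      · exact h.eq_of_length hlen
      · exact (h.eq_of_length hlen.symm).symm
    simp only [firstBits, List.range_succ, List.map_append, List.map_cons, List.map_nil] at heq
    have := List.append_inj_right heq (by simp)
    exact (List.cons.inj this).1

/-- The semi-measure `λ_Φ` induced by `Φ`: `λ_Φ(σ) = λ {X | Φ^X ⪰ σ}`. -/
noncomputable def inducedSemimeasure (Φ : TuringFunctional) (σ : List Bool) : ℝ≥0∞ :=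
  uniformMeasure {X | Φ.OutputExtends X σ}

end TuringFunctional

open Classical in
/-- The characteristic function of the halting problem `∅' = {e | the e-th program halts on input
e}`, as an oracle. -/
noncomputable def haltingOracle : ℕ →. ℕ := fun e =>
  Part.some (if ((Denumerable.ofNat Nat.Partrec.Code e).eval e).Dom then 1 else 0)

/-- A predicate is c.e. relative to the oracle `A` if it is the domain of a partial function that is
recursive in `A`. -/
def CEIn {α : Type} [Primcodable α] (A : ℕ →. ℕ) (p : α → Prop) : Prop :=
  RecursiveIn {A} fun a => Part.assert (p a) fun _ => Part.some ()

/-- A Martin-Löf test relative to the oracle `A`: a sequence of sets of strings, uniformly c.e. in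
`A`, that generate open sets of uniform measure at most `2 ^ (-i)`. -/
def IsMartinLofTest (A : ℕ →. ℕ) (U : ℕ → Set (List Bool)) : Prop :=
  CEIn A (fun p : ℕ × List Bool => p.2 ∈ U p.1) ∧
    ∀ i, uniformMeasure (openSet (U i)) ≤ (2⁻¹ : ℝ≥0∞) ^ i

/-- The set `2MLR` of 2-random sequences, those that pass every Martin-Löf test relative to `∅'`. -/
def twoRandom : Set CantorSeq :=
  {X | ∀ U : ℕ → Set (List Bool), IsMartinLofTest haltingOracle U → X ∉ ⋂ i, openSet (U i)}

end Shen

namespace Shen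

open MeasureTheory Encodable
open scoped ENNReal

/-! ### Predicates of the form `∃ x, ∀ y, R` with `R` primitive recursive -/

/-! Let `X` be 2-random with `Φ(X) = Y`; a 2-random `Z` with `Ψ(Z) = Y` is sought. For each `σ` the
set of oracles on which `Ψ` outputs an extension of `σ` is effectively open, so `∅'` finds a finite
stage, a clopen set `C_k(σ)`, that misses only a small part of it, with errors summing over `σ` to
at most `2 ^ (-(k+1))`. Let `V_k` (`coverTest`) consist of all the missed parts and a member of a
universal test relative to `∅'`; its measure is at most `2 ^ (-k)`. Outside `V_k`, the set `C_k(σ)`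
is exactly the preimage of `σ`, and every sequence is 2-random.

Call `σ` covered if `C_k(σ) ⊆ V_k`. By compactness (`exists_list_cover`) this is `Σ⁰₂`
(`isSigma2_coveredOutputs`). Oracles whose `Ψ`-output extends a covered string lie in `V_k`. The
induced semimeasure determines the measure of the preimage of any set of strings
(`measure_exists_outputExtends`), so the `Φ`-preimages of the covered strings also have measure at
most `2 ^ (-k)` and form a test relative to `∅'`. As `X` passes it, for some `k` no initial segment
of `Y` is covered. The sets `C_k(Y ↾ n) \ V_k` are then nonempty, closed and decreasing in `n`, and
a common point `Z` is as desired (`image_twoRandom_subset`).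

All effectivity is handled in `Σ⁰₂` normal form; Post's theorem (`IsSigma2.of_ceIn`,
`IsSigma2.ceIn`) translates to and from enumerability in `∅'`. -/

/-- `Σ⁰₂` predicates, in normal form. -/
def IsSigma2 {α : Type} [Primcodable α] (p : α → Prop) : Prop :=
  ∃ R : α × ℕ × ℕ → Bool, Primrec R ∧ ∀ a, p a ↔ ∃ x, ∀ y, R (a, x, y) = true

section Sigma2

variable {α β : Type} [Primcodable α] [Primcodable β]

theorem IsSigma2.of_eq {p q : α → Prop} (hp : IsSigma2 p) (h : ∀ a, p a ↔ q a) : IsSigma2 q := by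
  obtain ⟨R, hR, H⟩ := hp
  exact ⟨R, hR, fun a => (h a).symm.trans (H a)⟩

theorem IsSigma2.comp {p : α → Prop} (hp : IsSigma2 p) {f : β → α} (hf : Primrec f) :
    IsSigma2 fun b => p (f b) := by
  obtain ⟨R, hR, H⟩ := hp
  exact ⟨fun z => R (f z.1, z.2), hR.comp ((hf.comp .fst).pair .snd), fun b => H (f b)⟩

theorem IsSigma2.of_forall {p : α → Prop} {R : α × ℕ → Bool} (hR : Primrec R)
    (H : ∀ a, p a ↔ ∀ y, R (a, y) = true) : IsSigma2 p :=
  ⟨fun z => R (z.1, z.2.2), hR.comp (Primrec.fst.pair (Primrec.snd.comp .snd)), fun a => by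
    simp [H]⟩

theorem IsSigma2.of_exists {p : α → Prop} {R : α × ℕ → Bool} (hR : Primrec R)
    (H : ∀ a, p a ↔ ∃ x, R (a, x) = true) : IsSigma2 p :=
  ⟨fun z => R (z.1, z.2.1), hR.comp (Primrec.fst.pair (Primrec.fst.comp .snd)), fun a => by
    simp [H]⟩

theorem _root_.PrimrecPred.isSigma2 {p : α → Prop} (hp : PrimrecPred p) : IsSigma2 p := by
  obtain ⟨_, hd⟩ := hp
  exact .of_forall (R := fun z => decide (p z.1)) (hd.comp .fst) fun a => by simp

theorem IsSigma2.exists {p : α × β → Prop} (hp : IsSigma2 p) :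
    IsSigma2 fun a => ∃ b, p (a, b) := by
  obtain ⟨R, hR, H⟩ := hp
  -- The outer witness codes `b` together with the inner witness; the default `false` keeps invalid
  -- codes from being witnesses.
  refine ⟨fun z => ((decode (α := β × ℕ) z.2.1).map fun w => R ((z.1, w.1), w.2, z.2.2)).getD false,
    ?_, fun a => ?_⟩
  · refine Primrec.option_getD.comp (Primrec.option_map
      (Primrec.decode.comp (Primrec.fst.comp .snd)) ?_) (.const false)
    have h1 : Primrec fun q : (α × ℕ × ℕ) × β × ℕ => q.1.1 := Primrec.fst.comp .fst
    have h2 : Primrec fun q : (α × ℕ × ℕ) × β × ℕ => q.1.2.2 :=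
      Primrec.snd.comp (Primrec.snd.comp .fst)
    exact hR.comp ((h1.pair (Primrec.fst.comp .snd)).pair ((Primrec.snd.comp .snd).pair h2))
  · constructor
    · rintro ⟨b, hb⟩
      obtain ⟨x, hx⟩ := (H _).1 hb
      exact ⟨encode (b, x), fun y => by simpa using hx y⟩
    · rintro ⟨x, hx⟩
      cases hd : decode (α := β × ℕ) x with
      | none => simpa [hd] using hx 0
      | some w => exact ⟨w.1, (H _).2 ⟨w.2, fun y => by simpa [hd] using hx y⟩⟩

theorem IsSigma2.and {p q : α → Prop} (hp : IsSigma2 p) (hq : IsSigma2 q) :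
    IsSigma2 fun a => p a ∧ q a := by
  obtain ⟨R, hR, H⟩ := hp
  obtain ⟨S, hS, K⟩ := hq
  have hx : Primrec fun z : α × ℕ × ℕ => z.2.1.unpair :=
    Primrec.unpair.comp (Primrec.fst.comp .snd)
  refine ⟨fun z => R (z.1, z.2.1.unpair.1, z.2.2) && S (z.1, z.2.1.unpair.2, z.2.2),
    Primrec.and.comp
      (hR.comp (Primrec.fst.pair ((Primrec.fst.comp hx).pair (Primrec.snd.comp .snd))))
      (hS.comp (Primrec.fst.pair ((Primrec.snd.comp hx).pair (Primrec.snd.comp .snd)))),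
    fun a => ?_⟩
  simp only [Bool.and_eq_true]
  constructor
  · rintro ⟨h1, h2⟩
    obtain ⟨x, hx⟩ := (H a).1 h1
    obtain ⟨y, hy⟩ := (K a).1 h2
    exact ⟨Nat.pair x y, fun z => by simpa using ⟨hx z, hy z⟩⟩
  · rintro ⟨x, hx⟩
    exact ⟨(H a).2 ⟨_, fun y => (hx y).1⟩, (K a).2 ⟨_, fun y => (hx y).2⟩⟩

theorem IsSigma2.or {p q : α → Prop} (hp : IsSigma2 p) (hq : IsSigma2 q) :
    IsSigma2 fun a => p a ∨ q a := by
  obtain ⟨R, hR, H⟩ := hp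
  obtain ⟨S, hS, K⟩ := hq
  have hx : Primrec fun z : α × ℕ × ℕ => z.2.1.unpair :=
    Primrec.unpair.comp (Primrec.fst.comp .snd)
  -- The first component of the witness tells which disjunct is claimed: zero for `p`, anything else
  -- for `q`.
  refine ⟨fun z => bif z.2.1.unpair.1 == 0 then R (z.1, z.2.1.unpair.2, z.2.2)
      else S (z.1, z.2.1.unpair.2, z.2.2),
    Primrec.cond (Primrec.beq.comp (Primrec.fst.comp hx) (.const 0))
      (hR.comp (Primrec.fst.pair ((Primrec.snd.comp hx).pair (Primrec.snd.comp .snd))))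
      (hS.comp (Primrec.fst.pair ((Primrec.snd.comp hx).pair (Primrec.snd.comp .snd)))),
    fun a => ?_⟩
  constructor
  · rintro (h | h)
    · obtain ⟨x, hx⟩ := (H a).1 h
      exact ⟨Nat.pair 0 x, fun z => by simpa using hx z⟩
    · obtain ⟨x, hx⟩ := (K a).1 h
      exact ⟨Nat.pair 1 x, fun z => by simpa using hx z⟩
  · rintro ⟨x, hx⟩
    by_cases h : x.unpair.1 = 0
    · exact .inl ((H a).2 ⟨_, fun y => by simpa [h] using hx y⟩)
    · have h' : (x.unpair.1 == 0) = false := by simpa using h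
      exact .inr ((K a).2 ⟨_, fun y => by simpa only [h', cond_false] using hx y⟩)

/-- Finitely many witnesses can be collected in one list, which moves the existential quantifier in
front of the bounded one. The bounded variable then merges with the universal one in a single number
`y`. -/
theorem IsSigma2.forall_lt {p : α × ℕ → Prop} (hp : IsSigma2 p) {f : α → ℕ} (hf : Primrec f) :
    IsSigma2 fun a => ∀ m < f a, p (a, m) := by
  obtain ⟨R, hR, H⟩ := hp
  have key : IsSigma2 fun z : α × List ℕ =>
      ∀ y : ℕ, (f z.1 ≤ y.unpair.1 ∨ R ((z.1, y.unpair.1), z.2.getD y.unpair.1 0, y.unpair.2) = true) := by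
    refine .of_forall (R := fun z => decide (f z.1.1 ≤ z.2.unpair.1) ||
      R ((z.1.1, z.2.unpair.1), z.1.2.getD z.2.unpair.1 0, z.2.unpair.2)) ?_ fun a => by simp
    have hu : Primrec fun z : (α × List ℕ) × ℕ => z.2.unpair := Primrec.unpair.comp .snd
    have h1 : Primrec fun z : (α × List ℕ) × ℕ => z.2.unpair.1 := Primrec.fst.comp hu
    have ha : Primrec fun z : (α × List ℕ) × ℕ => z.1.1 := Primrec.fst.comp .fst
    refine Primrec.or.comp ?_ (hR.comp ((ha.pair h1).pair
      (((Primrec.list_getD 0).comp (Primrec.snd.comp .fst) h1).pair (Primrec.snd.comp hu))))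
    exact (Primrec.nat_le.comp (hf.comp ha) h1).decide
  refine key.exists.of_eq fun a => ?_
  constructor
  · rintro ⟨l, hl⟩ m hm
    refine (H _).2 ⟨l.getD m 0, fun y => ?_⟩
    have := hl (Nat.pair m y)
    simp only [Nat.unpair_pair] at this
    exact this.resolve_left (by omega)
  · intro h
    have : ∀ m, ∃ x, m < f a → ∀ y, R ((a, m), x, y) = true := fun m => by
      by_cases hm : m < f a
      · obtain ⟨x, hx⟩ := (H _).1 (h m hm)
        exact ⟨x, fun _ => hx⟩
      · exact ⟨0, fun h => absurd h hm⟩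
    choose g hg using this
    refine ⟨(List.range (f a)).map g, fun y => ?_⟩
    by_cases hm : y.unpair.1 < f a
    · right
      have : ((List.range (f a)).map g).getD y.unpair.1 0 = g y.unpair.1 := by
        simp [List.getD, hm]
      simp only [this]
      exact hg _ hm _
    · exact .inl (by simpa using hm)

theorem IsSigma2.forall_mem {p : α × β → Prop} (hp : IsSigma2 p) {f : α → List β}
    (hf : Primrec f) : IsSigma2 fun a => ∀ b ∈ f a, p (a, b) := by
  have h1 : IsSigma2 fun z : (α × ℕ) × β => (f z.1.1)[z.1.2]? = some z.2 ∧ p (z.1.1, z.2) := by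
    refine IsSigma2.and (PrimrecPred.isSigma2 ?_)
      (hp.comp ((Primrec.fst.comp .fst).pair .snd))
    exact Primrec.eq.comp (Primrec.list_getElem?.comp (hf.comp (Primrec.fst.comp .fst))
      (Primrec.snd.comp .fst)) (Primrec.option_some.comp .snd)
  refine (h1.exists.forall_lt (Primrec.list_length.comp hf)).of_eq fun a => ?_
  constructor
  · intro h b hb
    obtain ⟨m, hm, rfl⟩ := List.getElem_of_mem hb
    obtain ⟨b, hb, hp⟩ := h m hm
    simp only [List.getElem?_eq_getElem hm, Option.some.injEq] at hb
    rwa [hb]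
  · intro h m hm
    exact ⟨(f a)[m], List.getElem?_eq_getElem hm, h _ (List.getElem_mem hm)⟩

/-- The normal form of c.e. predicates. -/
theorem exists_primrec_of_rePred {p : α → Prop} (hp : REPred p) :
    ∃ R : α × ℕ → Bool, Primrec R ∧ ∀ a, p a ↔ ∃ n, R (a, n) = true := by
  obtain ⟨c, hc⟩ := Nat.Partrec.Code.exists_code.1 hp
  refine ⟨fun z => (c.evaln z.2 (encode z.1)).isSome, ?_, fun a => ?_⟩
  · exact Primrec.option_isSome.comp (Nat.Partrec.Code.primrec_evaln.comp
      ((Primrec.snd.pair (.const c)).pair (Primrec.encode.comp .fst)))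
  · have h1 : p a ↔ (c.eval (encode a)).Dom := by
      rw [hc]
      simp [Part.assert]
    rw [h1, Part.dom_iff_mem]
    simp only [Nat.Partrec.Code.evaln_complete, Option.isSome_iff_exists, Option.mem_def]
    exact exists_comm

theorem _root_.REPred.isSigma2 {p : α → Prop} (hp : REPred p) : IsSigma2 p := by
  obtain ⟨R, hR, H⟩ := exists_primrec_of_rePred hp
  exact .of_exists hR H

theorem _root_.REPred.isSigma2_not {p : α → Prop} (hp : REPred p) : IsSigma2 fun a => ¬ p a := by
  obtain ⟨R, hR, H⟩ := exists_primrec_of_rePred hp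
  exact .of_forall (R := fun z => !R z) (Primrec.not.comp hR) fun a => by simp [H]

end Sigma2

/-! ### Post's theorem: c.e. in the halting problem means `Σ⁰₂` -/

/-- `SelfHalts e`: the `e`-th program halts on input `e`. -/
def SelfHalts (e : ℕ) : Prop := ((Denumerable.ofNat Nat.Partrec.Code e).eval e).Dom

theorem selfHalts_re : REPred SelfHalts :=
  Partrec.dom_re (Nat.Partrec.Code.eval_part.comp (Computable.ofNat _) Computable.id)

theorem mem_haltingOracle {e b : ℕ} :
    b ∈ haltingOracle e ↔ (b = 1 ∧ SelfHalts e) ∨ (b = 0 ∧ ¬ SelfHalts e) := by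
  by_cases h : SelfHalts e
  · have h' := h
    unfold SelfHalts at h'
    simp [haltingOracle, h, h']
  · have h' := h
    unfold SelfHalts at h'
    simp [haltingOracle, h, h']

/-- A primitive recursion is witnessed by the list of its intermediate values. This form uses only
an existential and a bounded universal quantifier, under which `Σ⁰₂` is closed. -/
theorem mem_nat_rec_iff {f h : ℕ →. ℕ} {a n v : ℕ} :
    v ∈ (Nat.rec (f a) (fun y IH => IH >>= fun i => h (Nat.pair a (Nat.pair y i))) n : Part ℕ) ↔
      ∃ l : List ℕ, l.getD 0 0 ∈ f a ∧
        (∀ m < n, l.getD (m + 1) 0 ∈ h (Nat.pair a (Nat.pair m (l.getD m 0)))) ∧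
        l.getD n 0 = v := by
  constructor
  · intro hv
    -- The length is added to the induction claim so that appending `v` puts it at index `n + 1`.
    have : ∃ l : List ℕ, l.length = n + 1 ∧ l.getD 0 0 ∈ f a ∧
        (∀ m < n, l.getD (m + 1) 0 ∈ h (Nat.pair a (Nat.pair m (l.getD m 0)))) ∧
        l.getD n 0 = v := by
      induction n generalizing v with
      | zero => exact ⟨[v], rfl, by simpa using hv, by simp, by simp⟩
      | succ n ih =>
        obtain ⟨i, hi, hv⟩ := Part.mem_bind_iff.1 hv
        obtain ⟨l, hl, h0, h1, h2⟩ := ih hi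
        have hget : ∀ m ≤ n, (l ++ [v]).getD m 0 = l.getD m 0 := fun m hm => by
          simp [List.getD, List.getElem?_append_left (show m < l.length by omega)]
        have hlast : (l ++ [v]).getD (n + 1) 0 = v := by
          simp [List.getD, ← hl]
        refine ⟨l ++ [v], by simp [hl], by rwa [hget 0 (by omega)], fun m hm => ?_, hlast⟩
        rw [hget m (by omega)]
        rcases Nat.lt_or_ge m n with hm' | hm'
        · rw [hget (m + 1) (by omega)]
          exact h1 m hm'
        · obtain rfl : m = n := by omega
          rwa [hlast, h2]
    obtain ⟨l, -, hl⟩ := this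
    exact ⟨l, hl⟩
  · rintro ⟨l, h0, h1, rfl⟩
    induction n with
    | zero => exact h0
    | succ n ih => exact Part.mem_bind (ih fun m hm => h1 m (by omega)) (h1 n (by omega))

/-- Convergence to a nonzero value is expressed positively, so that no negation of the graph of `f`
is needed. -/
theorem mem_rfind_zero_iff {f : ℕ → Part ℕ} {n : ℕ} :
    n ∈ Nat.rfind (fun m => (fun k => decide (k = 0)) <$> f m : ℕ → Part Bool) ↔
      0 ∈ f n ∧ ∀ m < n, ∃ b, b ≠ 0 ∧ b ∈ f m := by
  have h1 : ∀ m, true ∈ (fun k => decide (k = 0)) <$> f m ↔ 0 ∈ f m := fun m => by simp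
  have h2 : ∀ m, false ∈ (fun k => decide (k = 0)) <$> f m ↔ ∃ b, b ≠ 0 ∧ b ∈ f m := fun m => by
    simp [and_comm]
  exact Nat.mem_rfind.trans (and_congr (h1 n) (forall₂_congr fun m _ => h2 m))

open Classical in
theorem rfind_zero_dom_iff {f : ℕ → Part ℕ} (hf : ∀ n, (f n).Dom) :
    (Nat.rfind (fun m => (fun k => decide (k = 0)) <$> f m : ℕ → Part Bool)).Dom ↔
      ∃ n, 0 ∈ f n := by
  rw [Part.dom_iff_mem]
  simp only [mem_rfind_zero_iff]
  refine ⟨fun ⟨n, hn, _⟩ => ⟨n, hn⟩, fun h => ⟨Nat.find h, Nat.find_spec h, fun m hm => ?_⟩⟩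
  exact ⟨_, fun h0 => Nat.find_min h hm (h0 ▸ Part.get_mem (hf m)), Part.get_mem (hf m)⟩

/-- The graph of a function that is recursive in the halting problem is `Σ⁰₂`. -/
theorem isSigma2_graph {f : ℕ →. ℕ} (hf : Nat.RecursiveIn {haltingOracle} f) :
    IsSigma2 fun p : ℕ × ℕ => p.2 ∈ f p.1 := by
  induction hf with
  | zero =>
    refine (PrimrecPred.isSigma2 (p := fun p : ℕ × ℕ => p.2 = 0)
      (Primrec.eq.comp .snd (.const 0))).of_eq fun p => ?_
    change _ ↔ p.2 ∈ Part.some 0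
    simp
  | succ =>
    exact (PrimrecPred.isSigma2 (p := fun p : ℕ × ℕ => p.2 = p.1.succ)
      (Primrec.eq.comp .snd (Primrec.succ.comp .fst))).of_eq fun p => by simp
  | left =>
    exact (PrimrecPred.isSigma2 (p := fun p : ℕ × ℕ => p.2 = p.1.unpair.1)
      (Primrec.eq.comp .snd (Primrec.fst.comp (Primrec.unpair.comp .fst)))).of_eq fun p => by simp
  | right =>
    exact (PrimrecPred.isSigma2 (p := fun p : ℕ × ℕ => p.2 = p.1.unpair.2)
      (Primrec.eq.comp .snd (Primrec.snd.comp (Primrec.unpair.comp .fst)))).of_eq fun p => by simp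
  | oracle g hg =>
    obtain rfl : g = haltingOracle := hg
    -- The oracle answers 1 on a c.e. condition and 0 on a co-c.e. one; both are `Σ⁰₂`.
    have h1 : IsSigma2 fun p : ℕ × ℕ => SelfHalts p.1 := selfHalts_re.isSigma2.comp .fst
    have h2 : IsSigma2 fun p : ℕ × ℕ => ¬ SelfHalts p.1 :=
      selfHalts_re.isSigma2_not.comp (f := Prod.fst) .fst
    have hb : ∀ c : ℕ, IsSigma2 fun p : ℕ × ℕ => p.2 = c := fun c =>
      PrimrecPred.isSigma2 (Primrec.eq.comp .snd (.const c))
    exact (((hb 1).and h1).or ((hb 0).and h2)).of_eq fun p => mem_haltingOracle.symm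
  | @pair f h _ _ ihf ihh =>
    have h1 : IsSigma2 fun z : (ℕ × ℕ) × ℕ × ℕ => z.2.1 ∈ f z.1.1 :=
      ihf.comp ((Primrec.fst.comp .fst).pair (Primrec.fst.comp .snd))
    have h2 : IsSigma2 fun z : (ℕ × ℕ) × ℕ × ℕ => z.2.2 ∈ h z.1.1 :=
      ihh.comp ((Primrec.fst.comp .fst).pair (Primrec.snd.comp .snd))
    have h3 : IsSigma2 fun z : (ℕ × ℕ) × ℕ × ℕ => z.1.2 = Nat.pair z.2.1 z.2.2 :=
      PrimrecPred.isSigma2 (Primrec.eq.comp (Primrec.snd.comp .fst)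
        (Primrec₂.natPair.comp (Primrec.fst.comp .snd) (Primrec.snd.comp .snd)))
    refine (h1.and (h2.and h3)).exists.of_eq fun p => ?_
    simp [Seq.seq, eq_comm]
  | @comp f h _ _ ihf ihh =>
    have h1 : IsSigma2 fun z : (ℕ × ℕ) × ℕ => z.2 ∈ h z.1.1 :=
      ihh.comp ((Primrec.fst.comp .fst).pair .snd)
    have h2 : IsSigma2 fun z : (ℕ × ℕ) × ℕ => z.1.2 ∈ f z.2 :=
      ihf.comp (Primrec.snd.pair (Primrec.snd.comp .fst))
    refine (h1.and h2).exists.of_eq fun p => ?_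
    change _ ↔ p.2 ∈ (h p.1).bind f
    exact (Part.mem_bind_iff (f := h p.1) (g := f) (b := p.2)).symm
  | @prec f h _ _ ihf ihh =>
    have hget : Primrec₂ fun (l : List ℕ) n => l.getD n 0 := Primrec.list_getD 0
    have ha : Primrec fun p : ℕ × ℕ => p.1.unpair.1 := Primrec.fst.comp (Primrec.unpair.comp .fst)
    have hn : Primrec fun p : ℕ × ℕ => p.1.unpair.2 := Primrec.snd.comp (Primrec.unpair.comp .fst)
    have h1 : IsSigma2 fun z : (ℕ × ℕ) × List ℕ => z.2.getD 0 0 ∈ f z.1.1.unpair.1 :=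
      ihf.comp ((ha.comp .fst).pair (hget.comp .snd (.const 0)))
    have h2 : IsSigma2 fun z : ((ℕ × ℕ) × List ℕ) × ℕ => z.1.2.getD (z.2 + 1) 0 ∈
        h (Nat.pair z.1.1.1.unpair.1 (Nat.pair z.2 (z.1.2.getD z.2 0))) :=
      ihh.comp (Primrec.pair
        (Primrec₂.natPair.comp (ha.comp (Primrec.fst.comp .fst))
          (Primrec₂.natPair.comp .snd (hget.comp (Primrec.snd.comp .fst) .snd)))
        (hget.comp (Primrec.snd.comp .fst) (Primrec.succ.comp .snd)))
    have h3 : IsSigma2 fun z : (ℕ × ℕ) × List ℕ => z.2.getD z.1.1.unpair.2 0 = z.1.2 :=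
      PrimrecPred.isSigma2 (Primrec.eq.comp (hget.comp .snd (hn.comp .fst)) (Primrec.snd.comp .fst))
    exact (h1.and ((h2.forall_lt (hn.comp .fst)).and h3)).exists.of_eq fun p =>
      (mem_nat_rec_iff (f := f) (h := h) (a := p.1.unpair.1) (n := p.1.unpair.2)
        (v := p.2)).symm
  | @rfind f _ ihf =>
    have h1 : IsSigma2 fun p : ℕ × ℕ => 0 ∈ f (Nat.pair p.1 p.2) :=
      ihf.comp ((Primrec₂.natPair.comp .fst .snd).pair (.const 0))
    have h2 : IsSigma2 fun z : ((ℕ × ℕ) × ℕ) × ℕ =>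
        z.2 ≠ 0 ∧ z.2 ∈ f (Nat.pair z.1.1.1 z.1.2) :=
      IsSigma2.and (PrimrecPred.isSigma2 (Primrec.eq.comp .snd (.const 0)).not)
        (ihf.comp ((Primrec₂.natPair.comp (Primrec.fst.comp (Primrec.fst.comp .fst))
          (Primrec.snd.comp .fst)).pair .snd))
    refine (h1.and (h2.exists.forall_lt .snd)).of_eq fun p => ?_
    exact (mem_rfind_zero_iff (f := fun m => f (Nat.pair p.1 m))).symm

theorem mem_map_assert_iff {q : Prop} {v : ℕ} :
    v ∈ (Part.assert q fun _ => Part.some ()).map encode ↔ q ∧ v = 0 := by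
  rw [Part.mem_map_iff]
  constructor
  · rintro ⟨u, ⟨⟨hq, -⟩, -⟩, rfl⟩
    exact ⟨hq, rfl⟩
  · rintro ⟨hq, rfl⟩
    exact ⟨(), ⟨⟨hq, trivial⟩, rfl⟩, rfl⟩

/-- The value `()` has code 0, so `p` is the slice of a `Σ⁰₂` graph at the value 0. -/
theorem IsSigma2.of_ceIn {α : Type} [Primcodable α] {p : α → Prop} (hp : CEIn haltingOracle p) :
    IsSigma2 p := by
  refine ((isSigma2_graph hp).comp (Primrec.encode.pair (.const 0))).of_eq fun a => ?_
  change 0 ∈ ((decode (α := α) (encode a) : Option α) : Part α).bind _ ↔ _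
  rw [encodek, Part.coe_some, Part.bind_some]
  exact mem_map_assert_iff.trans (and_iff_left rfl)

theorem rePred_exists {α : Type} [Primcodable α] {R : α × ℕ → Bool} (hR : Primrec R) :
    REPred fun a => ∃ n, R (a, n) = true := by
  have : Partrec fun a => Nat.rfind fun n => Part.some (R (a, n)) :=
    Partrec.rfind hR.to_comp.partrec
  refine this.dom_re.of_eq fun a => Part.dom_iff_mem.trans ?_
  constructor
  · rintro ⟨n, hn⟩
    exact ⟨n, (Part.mem_some_iff.1 (Nat.mem_rfind.1 hn).1).symm⟩
  · intro h
    exact ⟨Nat.find h, Nat.mem_rfind.2 ⟨Part.mem_some_iff.2 (Nat.find_spec h).symm, fun hm =>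
      Part.mem_some_iff.2 (Bool.eq_false_iff.2 (Nat.find_min h hm)).symm⟩⟩

/-- The halting problem is `m`-complete. -/
theorem exists_primrec_selfHalts {q : ℕ → Prop} (hq : REPred q) :
    ∃ t : ℕ → ℕ, Primrec t ∧ ∀ n, SelfHalts (t n) ↔ q n := by
  -- The second component is ignored, so the curried program behaves the same on every input, in
  -- particular on its own code.
  have : REPred fun z : ℕ => q z.unpair.1 :=
    Partrec.comp hq (Computable.fst.comp Computable.unpair)
  obtain ⟨c, hc⟩ := Nat.Partrec.Code.exists_code.1 this
  refine ⟨fun n => encode (c.curry n),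
    Primrec.encode.comp (Nat.Partrec.Code.primrec₂_curry.comp (.const c) .id), fun n => ?_⟩
  simp [SelfHalts, Nat.Partrec.Code.eval_curry, hc, Part.assert]

/-- That `x` fails to be a witness is a c.e. event, hence reducible to the halting problem. A search
for an `x` on which the oracle answers 0 therefore halts exactly if a witness exists. -/
theorem IsSigma2.ceIn {α : Type} [Primcodable α] {p : α → Prop} (hp : IsSigma2 p) :
    CEIn haltingOracle p := by
  obtain ⟨R, hR, H⟩ := hp
  have hS : Primrec fun z : ℕ × ℕ =>
      -- With the default `true`, numbers that code no element of `α` are refuted at once, so the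
      -- search diverges on them.
      ((decode (α := α × ℕ) z.1).map fun w => !R (w.1, w.2, z.2)).getD true := by
    refine Primrec.option_getD.comp (Primrec.option_map (Primrec.decode.comp .fst) ?_) (.const true)
    exact Primrec.not.comp (hR.comp ((Primrec.fst.comp .snd).pair
      ((Primrec.snd.comp .snd).pair (Primrec.snd.comp .fst))))
  obtain ⟨t, ht, hT⟩ := exists_primrec_selfHalts (rePred_exists hS)
  have h1 : Nat.RecursiveIn {haltingOracle} fun n => (Part.some (t n)) >>= haltingOracle :=
    .comp (.oracle _ rfl) (Nat.Primrec.recursiveIn (Primrec.nat_iff.1 ht))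
  refine Nat.RecursiveIn.of_eq (.comp .zero (.rfind h1)) fun n => ?_
  have key : ∀ x, 0 ∈ haltingOracle (t (Nat.pair n x)) ↔
      ∃ a, decode (α := α) n = some a ∧ ∀ y, R (a, x, y) = true := fun x => by
    rw [mem_haltingOracle, hT]
    cases hd : decode (α := α) n <;> simp [hd]
  have hdom : (Nat.rfind (fun x => (fun m => decide (m = 0)) <$>
      (Part.some (t (Nat.pair n x))).bind haltingOracle : ℕ → Part Bool)).Dom ↔
      ∃ a, decode (α := α) n = some a ∧ p a := by
    refine (rfind_zero_dom_iff
      (f := fun x => (Part.some (t (Nat.pair n x))).bind haltingOracle)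
      fun _ => ⟨trivial, trivial⟩).trans ?_
    have hb : ∀ x, (Part.some (t (Nat.pair n x))).bind haltingOracle =
        haltingOracle (t (Nat.pair n x)) := fun x => Part.bind_some _ _
    simp only [hb, key, H]
    constructor
    · rintro ⟨x, a, h, hx⟩
      exact ⟨a, h, x, hx⟩
    · rintro ⟨a, h, x, hx⟩
      exact ⟨x, a, h, hx⟩
  ext v
  refine Part.mem_bind_iff.trans (Iff.trans ?_ Part.mem_bind_iff.symm)
  simp only [mem_map_assert_iff, Part.mem_coe, Option.mem_def]
  constructor
  · rintro ⟨x, hx, hv⟩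
    obtain ⟨a, ha, hpa⟩ := hdom.1 (Part.dom_iff_mem.2 ⟨x, hx⟩)
    exact ⟨a, ha, hpa, Part.mem_some_iff.1 hv⟩
  · rintro ⟨a, ha, hpa, hv⟩
    obtain ⟨x, hx⟩ := Part.dom_iff_mem.1 (hdom.2 ⟨a, ha, hpa⟩)
    exact ⟨x, hx, Part.mem_some_iff.2 hv⟩

/-! ### Cylinders and finite unions of cylinders -/

@[simp]
theorem length_firstBits (X : CantorSeq) (n : ℕ) : (firstBits X n).length = n := by
  simp [firstBits]

theorem isInitial_firstBits (X : CantorSeq) (n : ℕ) : IsInitial (firstBits X n) X := by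
  simp [IsInitial]

theorem firstBits_prefix (X : CantorSeq) {m n : ℕ} (h : m ≤ n) :
    firstBits X m <+: firstBits X n := by
  obtain ⟨c, rfl⟩ := Nat.exists_eq_add_of_le h
  simp [firstBits, List.range_add]

theorem isInitial_iff_prefix {σ : List Bool} {X : CantorSeq} {n : ℕ} (h : σ.length ≤ n) :
    IsInitial σ X ↔ σ <+: firstBits X n := by
  constructor
  · intro hσ
    have := firstBits_prefix X h
    rwa [hσ] at this
  · intro hσ
    exact ((List.prefix_of_prefix_length_le hσ (firstBits_prefix X h) (by simp)).eq_of_length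
      (by simp)).symm

theorem IsInitial.of_prefix {σ τ : List Bool} {X : CantorSeq} (hτ : IsInitial τ X)
    (h : σ <+: τ) : IsInitial σ X :=
  (isInitial_iff_prefix h.length_le).2 (by rwa [hτ])

theorem exists_isInitial (τ : List Bool) : ∃ X, IsInitial τ X := by
  refine ⟨fun i => τ.getD i false, List.ext_getElem (by simp) fun i h1 h2 => ?_⟩
  simp [firstBits, List.getD, h2]

theorem openSet_mono {S T : Set (List Bool)} (h : S ⊆ T) : openSet S ⊆ openSet T :=
  fun _ ⟨σ, hσ, hX⟩ => ⟨σ, h hσ, hX⟩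

theorem openSet_eq_biUnion (S : Set (List Bool)) : openSet S = ⋃ σ ∈ S, openSet {σ} := by
  ext X
  simp [openSet]

theorem openSet_union (S T : Set (List Bool)) : openSet (S ∪ T) = openSet S ∪ openSet T := by
  rw [openSet_eq_biUnion, openSet_eq_biUnion S, openSet_eq_biUnion T, Set.biUnion_union]

theorem openSet_iUnion {ι : Type*} (S : ι → Set (List Bool)) :
    openSet (⋃ i, S i) = ⋃ i, openSet (S i) := by
  ext X
  simp only [openSet, Set.mem_iUnion, Set.mem_ofPred_eq]
  constructor
  · rintro ⟨σ, ⟨i, hi⟩, hX⟩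
    exact ⟨i, σ, hi, hX⟩
  · rintro ⟨i, σ, hi, hX⟩
    exact ⟨σ, ⟨i, hi⟩, hX⟩

theorem isClopen_cylinder (σ : List Bool) : IsClopen (openSet {σ}) := by
  have h : openSet {σ} = (fun X => firstBits X σ.length) ⁻¹' {σ} := by
    ext X
    simp [openSet, IsInitial]
  have hc : Continuous fun X : CantorSeq => fun i : Fin σ.length => X i :=
    continuous_pi fun i => continuous_apply _
  have h2 : openSet {σ} = (fun X : CantorSeq => fun i : Fin σ.length => X i) ⁻¹'
      {f | List.ofFn f = σ} := by
    rw [h]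
    ext X
    have : firstBits X σ.length = List.ofFn fun i : Fin σ.length => X i := by
      apply List.ext_getElem <;> simp [firstBits]
    simp only [Set.mem_preimage, Set.mem_singleton_iff, this, Set.mem_ofPred_eq]
  rw [h2]
  exact (isClopen_discrete _).preimage hc

theorem isOpen_openSet (S : Set (List Bool)) : IsOpen (openSet S) := by
  rw [openSet_eq_biUnion]
  exact isOpen_biUnion fun σ _ => (isClopen_cylinder σ).isOpen

theorem measurableSet_openSet (S : Set (List Bool)) : MeasurableSet (openSet S) :=
  (isOpen_openSet S).measurableSet

/-- The clopen set generated by a finite list of strings. -/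
def clopenSet (L : List (List Bool)) : Set CantorSeq := openSet {σ | σ ∈ L}

theorem mem_clopenSet {L : List (List Bool)} {X : CantorSeq} :
    X ∈ clopenSet L ↔ ∃ σ ∈ L, IsInitial σ X := Iff.rfl

theorem clopenSet_mono {L M : List (List Bool)} (h : L ⊆ M) : clopenSet L ⊆ clopenSet M :=
  openSet_mono h

theorem isClosed_clopenSet (L : List (List Bool)) : IsClosed (clopenSet L) := by
  rw [clopenSet, openSet_eq_biUnion]
  exact (List.finite_toSet L).isClosed_biUnion fun σ _ => (isClopen_cylinder σ).isClosed

theorem measurableSet_clopenSet (L : List (List Bool)) : MeasurableSet (clopenSet L) :=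
  measurableSet_openSet _

/-- Compactness makes the inclusion of a clopen set in an open set a finite event: it is witnessed
by a list of strings from `S`. -/
theorem exists_list_cover {L : List (List Bool)} {S : Set (List Bool)}
    (h : clopenSet L ⊆ openSet S) : ∃ M : List (List Bool), (∀ σ ∈ M, σ ∈ S) ∧
      clopenSet L ⊆ clopenSet M := by
  classical
  rw [openSet_eq_biUnion, Set.biUnion_eq_iUnion] at h
  obtain ⟨t, ht⟩ := (isClosed_clopenSet L).isCompact.elim_finite_subcover _
    (fun σ : S => (isClopen_cylinder σ.1).isOpen) h
  refine ⟨t.toList.map Subtype.val, ?_, fun X hX => ?_⟩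
  · intro σ hσ
    obtain ⟨τ, -, rfl⟩ := List.mem_map.1 hσ
    exact τ.2
  · obtain ⟨σ, hσ, hX⟩ := Set.mem_iUnion₂.1 (ht hX)
    obtain ⟨τ, rfl, hX⟩ := hX
    exact ⟨σ.1, List.mem_map.2 ⟨σ, by simpa using hσ, rfl⟩, hX⟩

instance : IsProbabilityMeasure uniformMeasure := by
  unfold uniformMeasure
  infer_instance

/-! ### Strings of a given length -/

/-- All strings of length `n`. -/
def strings (n : ℕ) : List (List Bool) :=
  n.rec [[]] fun _ L => L.flatMap fun τ => [false :: τ, true :: τ]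

theorem mem_strings {n : ℕ} {τ : List Bool} : τ ∈ strings n ↔ τ.length = n := by
  induction n generalizing τ with
  | zero => simp [strings]
  | succ n ih =>
    have : strings (n + 1) = (strings n).flatMap fun τ => [false :: τ, true :: τ] := rfl
    rw [this, List.mem_flatMap]
    simp only [ih]
    cases τ with
    | nil => simp
    | cons b τ => cases b <;> simp

theorem nodup_strings (n : ℕ) : (strings n).Nodup := by
  induction n with
  | zero => simp [strings]
  | succ n ih =>
    have : strings (n + 1) = (strings n).flatMap fun τ => [false :: τ, true :: τ] := rfl
    rw [this, List.nodup_flatMap]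
    refine ⟨fun _ _ => by simp, ih.imp fun {a b} hab => ?_⟩
    simp [Function.onFun, hab.symm]

theorem primrec_strings : Primrec strings := by
  refine Primrec.nat_rec₁ [[]] ?_
  refine Primrec.list_flatMap .snd ?_
  have h : ∀ b : Bool, Primrec₂ fun (_ : ℕ × List (List Bool)) (τ : List Bool) => b :: τ :=
    fun b => Primrec.list_cons.comp (.const b) .snd
  exact Primrec.list_cons.comp (h false) (Primrec.list_cons.comp (h true) (.const []))

theorem primrecRel_prefix : PrimrecRel fun σ τ : List Bool => σ <+: τ := by
  refine PrimrecRel.of_eq (r := fun σ τ : List Bool => σ = τ.take σ.length) ?_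
    fun σ τ => List.prefix_iff_eq_take.symm
  exact Primrec.eq.comp .fst (Primrec.list_take.comp (Primrec.list_length.comp .fst) .snd)

theorem primrecRel_exists_prefix :
    PrimrecRel fun (L : List (List Bool)) (τ : List Bool) => ∃ σ ∈ L, σ <+: τ :=
  primrecRel_prefix.exists_mem_list

/-- The strings of length `n` that extend a string in `L`. -/
def extensions (L : List (List Bool)) (n : ℕ) : List (List Bool) :=
  (strings n).filter fun τ => ∃ σ ∈ L, σ <+: τ

theorem mem_extensions {L : List (List Bool)} {n : ℕ} {τ : List Bool} :
    τ ∈ extensions L n ↔ τ.length = n ∧ ∃ σ ∈ L, σ <+: τ := by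
  simp [extensions, mem_strings]

theorem primrec_extensions : Primrec₂ extensions := by
  have h : PrimrecRel fun (τ : List Bool) (L : List (List Bool)) => ∃ σ ∈ L, σ <+: τ :=
    primrecRel_exists_prefix.swap
  exact (h.listFilter.comp (primrec_strings.comp .snd) .fst :
    Primrec fun z : List (List Bool) × ℕ => extensions z.1 z.2)

theorem clopenSet_extensions {L : List (List Bool)} {n : ℕ} (h : ∀ σ ∈ L, σ.length ≤ n) :
    clopenSet (extensions L n) = clopenSet L := by
  ext X
  simp only [mem_clopenSet, mem_extensions]
  constructor
  · rintro ⟨τ, ⟨-, σ, hσ, hp⟩, hX⟩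
    exact ⟨σ, hσ, hX.of_prefix hp⟩
  · rintro ⟨σ, hσ, hX⟩
    exact ⟨firstBits X n, ⟨by simp, σ, hσ, (isInitial_iff_prefix (h σ hσ)).1 hX⟩,
      isInitial_firstBits X n⟩

/-! ### Deciding measure comparison and inclusion of clopen sets -/

theorem measure_clopenSet {L : List (List Bool)} {n : ℕ} (h : ∀ σ ∈ L, σ.length ≤ n) :
    uniformMeasure (clopenSet L) = (extensions L n).length * (2⁻¹ : ℝ≥0∞) ^ n := by
  classical
  have hnd : (extensions L n).Nodup := (nodup_strings n).filter _
  have hU : clopenSet L = ⋃ τ ∈ (extensions L n).toFinset, openSet {τ} := by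
    rw [← clopenSet_extensions h, clopenSet, openSet_eq_biUnion]
    simp
  rw [hU, measure_biUnion_finset]
  · rw [Finset.sum_congr rfl (g := fun _ => (2⁻¹ : ℝ≥0∞) ^ n), Finset.sum_const,
      List.toFinset_card_of_nodup hnd, nsmul_eq_mul]
    intro τ hτ
    rw [uniformMeasure_cylinder, (mem_extensions.1 (List.mem_toFinset.1 hτ)).1]
  · intro σ hσ τ hτ hne
    rw [Function.onFun, Set.disjoint_left]
    rintro X ⟨_, rfl, h1⟩ ⟨_, rfl, h2⟩
    refine hne ?_
    have e1 := (mem_extensions.1 (List.mem_toFinset.1 hσ)).1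
    have e2 := (mem_extensions.1 (List.mem_toFinset.1 hτ)).1
    rw [← h1, ← h2, e1, e2]
  · exact fun τ _ => measurableSet_openSet _

/-- The total length is a convenient primitive recursive bound on all lengths in the list. -/
theorem length_le_flatten {L : List (List Bool)} {σ : List Bool} (h : σ ∈ L) :
    σ.length ≤ L.flatten.length := by
  rw [List.length_flatten]
  exact List.single_le_sum (by simp) _ (List.mem_map_of_mem h)

theorem primrec_flatten_length :
    Primrec fun L : List (List Bool) => L.flatten.length :=
  Primrec.list_length.comp Primrec.list_flatten

/-- Comparing the measures of clopen sets up to `2 ^ (-m)` is primitive recursive. -/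
theorem primrecPred_measure_le :
    PrimrecPred fun z : (List (List Bool) × List (List Bool)) × ℕ =>
      uniformMeasure (clopenSet z.1.1) ≤ uniformMeasure (clopenSet z.1.2) + (2⁻¹ : ℝ≥0∞) ^ z.2 := by
  have hd : Primrec fun z : (List (List Bool) × List (List Bool)) × ℕ =>
      (z.1.1 ++ z.1.2).flatten.length :=
    primrec_flatten_length.comp (Primrec.list_append.comp (Primrec.fst.comp .fst)
      (Primrec.snd.comp .fst))
  have hn := Primrec.nat_add.comp hd
    (Primrec.snd : Primrec fun z : (List (List Bool) × List (List Bool)) × ℕ => z.2)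
  have hpow : Primrec₂ ((· ^ ·) : ℕ → ℕ → ℕ) := Primrec₂.unpaired'.1 Nat.Primrec.pow
  -- At the common length `d + m` all cylinders weigh `2 ^ (-(d + m))`, and `2 ^ (-m)` is the weight
  -- of `2 ^ d` of them, so the comparison is one of natural numbers.
  refine PrimrecPred.of_eq (Primrec.nat_le.comp
    (Primrec.list_length.comp (primrec_extensions.comp (Primrec.fst.comp .fst) hn))
    (Primrec.nat_add.comp
      (Primrec.list_length.comp (primrec_extensions.comp (Primrec.snd.comp .fst) hn))
      (hpow.comp (.const 2) hd))) ?_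
  rintro ⟨⟨L, M⟩, m⟩
  simp only
  set d := (L ++ M).flatten.length with hdef
  have hL : ∀ σ ∈ L, σ.length ≤ d + m := fun σ hσ =>
    (length_le_flatten (List.mem_append_left M hσ)).trans (Nat.le_add_right _ _)
  have hM : ∀ σ ∈ M, σ.length ≤ d + m := fun σ hσ =>
    (length_le_flatten (List.mem_append_right L hσ)).trans (Nat.le_add_right _ _)
  rw [measure_clopenSet hL, measure_clopenSet hM]
  have h2 : (2⁻¹ : ℝ≥0∞) ^ m = ((2 ^ d : ℕ) : ℝ≥0∞) * 2⁻¹ ^ (d + m) := by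
    rw [pow_add, ← mul_assoc, Nat.cast_pow, ← mul_pow, Nat.cast_ofNat,
      ENNReal.mul_inv_cancel (by simp) (by simp), one_pow, one_mul]
  rw [h2, ← add_mul, ENNReal.mul_le_mul_iff_left (by simp) (by simp)]
  exact_mod_cast Iff.rfl

/-- Inclusion between clopen sets is primitive recursive. -/
theorem primrecPred_clopenSet_subset :
    PrimrecPred fun z : List (List Bool) × List (List Bool) =>
      clopenSet z.1 ⊆ clopenSet z.2 := by
  have hn : Primrec fun z : List (List Bool) × List (List Bool) => (z.1 ++ z.2).flatten.length :=
    primrec_flatten_length.comp (Primrec.list_append.comp .fst .snd)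
  have h : PrimrecRel fun (τ : List Bool) (L : List (List Bool)) => ∃ σ ∈ L, σ <+: τ :=
    primrecRel_exists_prefix.swap
  refine PrimrecPred.of_eq (h.forall_mem_list.comp (primrec_extensions.comp .fst hn) .snd) ?_
  rintro ⟨L, M⟩
  simp only [mem_extensions]
  have hL : ∀ σ ∈ L, σ.length ≤ (L ++ M).flatten.length := fun σ hσ =>
    length_le_flatten (List.mem_append_left M hσ)
  have hM : ∀ σ ∈ M, σ.length ≤ (L ++ M).flatten.length := fun σ hσ =>
    length_le_flatten (List.mem_append_right L hσ)
  constructor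
  · rintro H X ⟨σ, hσ, hX⟩
    obtain ⟨ρ, hρ, hp⟩ := H (firstBits X _)
      ⟨length_firstBits _ _, σ, hσ, (isInitial_iff_prefix (hL σ hσ)).1 hX⟩
    exact ⟨ρ, hρ, (isInitial_firstBits X _).of_prefix hp⟩
  · rintro H τ ⟨hτ, σ, hσ, hp⟩
    obtain ⟨X, hX⟩ := exists_isInitial τ
    obtain ⟨ρ, hρ, hX'⟩ := H ⟨σ, hσ, hX.of_prefix hp⟩
    refine ⟨ρ, hρ, ?_⟩
    rw [← hX, hτ]
    exact (isInitial_iff_prefix (hM ρ hρ)).1 hX'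

/-! ### Monotone finite approximations of open sets -/

/-- A uniformly c.e. family of sets of strings has uniformly primitive recursive, increasing finite
approximations. -/
theorem exists_primrec_approx {α β : Type} [Primcodable α] [Primcodable β] {p : α × β → Prop}
    (hp : REPred p) : ∃ A : α → ℕ → List β, Primrec₂ A ∧ (∀ a s t, s ≤ t → A a s ⊆ A a t) ∧
      ∀ a b, p (a, b) ↔ ∃ s, b ∈ A a s := by
  obtain ⟨R, hR, H⟩ := exists_primrec_of_rePred hp
  let g : α → ℕ → Option β := fun a j =>
    (decode (α := β × ℕ) j).bind fun w => bif R ((a, w.1), w.2) then some w.1 else none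
  have hg : Primrec₂ g := by
    refine Primrec.option_bind (Primrec.decode.comp .snd) ?_
    refine Primrec.cond (hR.comp (Primrec.pair ?_ (Primrec.snd.comp .snd)))
      (Primrec.option_some.comp (Primrec.fst.comp .snd)) (.const none)
    exact (Primrec.fst.comp .fst).pair (Primrec.fst.comp .snd)
  refine ⟨fun a s => (List.range s).filterMap (g a), ?_, fun a s t hst b hb => ?_, fun a b => ?_⟩
  · exact Primrec.listFilterMap (Primrec.list_range.comp .snd)
      (hg.comp (Primrec.fst.comp .fst) .snd)
  · simp only [List.mem_filterMap, List.mem_range] at hb ⊢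
    obtain ⟨j, hj, h⟩ := hb
    exact ⟨j, hj.trans_le hst, h⟩
  · rw [H]
    simp only [List.mem_filterMap, List.mem_range]
    constructor
    · rintro ⟨n, hn⟩
      exact ⟨encode (b, n) + 1, encode (b, n), Nat.lt_succ_self _, by simp [g, hn]⟩
    · rintro ⟨s, j, -, hj⟩
      obtain ⟨w, -, hw⟩ := Option.bind_eq_some_iff.1 hj
      cases h : R ((a, w.1), w.2)
      · simp [h] at hw
      · simp only [h, cond_true, Option.some.injEq] at hw
        subst hw
        exact ⟨_, h⟩

/-- The stage `s` of the approximation `A` comes within `2 ^ (-m)` of the measure of the limit. -/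
def IsCloseStage (A : ℕ → List (List Bool)) (m s : ℕ) : Prop :=
  ∀ t, uniformMeasure (clopenSet (A t)) ≤ uniformMeasure (clopenSet (A s)) + (2⁻¹ : ℝ≥0∞) ^ m

theorem clopenSet_stages {A : ℕ → List (List Bool)} {S : Set (List Bool)}
    (hS : ∀ ρ, ρ ∈ S ↔ ∃ s, ρ ∈ A s) : openSet S = ⋃ s, clopenSet (A s) := by
  simp only [clopenSet]
  rw [← openSet_iUnion]
  congr 1
  ext ρ
  simp [hS]

theorem measure_openSet_stages {A : ℕ → List (List Bool)} (hA : ∀ s t, s ≤ t → A s ⊆ A t)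
    {S : Set (List Bool)} (hS : ∀ ρ, ρ ∈ S ↔ ∃ s, ρ ∈ A s) :
    uniformMeasure (openSet S) = ⨆ s, uniformMeasure (clopenSet (A s)) := by
  rw [clopenSet_stages hS]
  exact Monotone.measure_iUnion fun s t h => clopenSet_mono (hA s t h)

theorem exists_isCloseStage {A : ℕ → List (List Bool)} (m : ℕ) : ∃ s, IsCloseStage A m s := by
  set f : ℕ → ℝ≥0∞ := fun s => uniformMeasure (clopenSet (A s)) with hf
  have hle : ⨆ s, f s ≤ 1 := iSup_le fun s => prob_le_one
  suffices h : ∃ s, ⨆ s, f s ≤ f s + (2⁻¹ : ℝ≥0∞) ^ m from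
    h.imp fun s hs t => (le_iSup f t).trans hs
  by_cases h0 : ⨆ s, f s = 0
  · exact ⟨0, by simp [h0]⟩
  · have : (⨆ s, f s) - (2⁻¹ : ℝ≥0∞) ^ m < ⨆ s, f s :=
      ENNReal.sub_lt_self (hle.trans_lt ENNReal.one_lt_top).ne h0 (by simp)
    obtain ⟨s, hs⟩ := lt_iSup_iff.1 this
    exact ⟨s, tsub_le_iff_right.1 hs.le⟩

open Classical in
/-- The first stage of `A` that is within `2 ^ (-m)` of the limit. -/
noncomputable def closeStage (A : ℕ → List (List Bool)) (m : ℕ) : ℕ :=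
  Nat.find (exists_isCloseStage (A := A) m)

theorem isCloseStage_closeStage (A : ℕ → List (List Bool)) (m : ℕ) :
    IsCloseStage A m (closeStage A m) := by
  classical
  exact Nat.find_spec (exists_isCloseStage m)

theorem closeStage_eq_iff {A : ℕ → List (List Bool)} {m s : ℕ} :
    closeStage A m = s ↔ IsCloseStage A m s ∧ ∀ t < s, ¬ IsCloseStage A m t := by
  classical
  exact Nat.find_eq_iff _

/-- Closeness asks a decidable comparison for every `t`, and its failure is existential. Being the
first close stage combines the former with boundedly many of the latter. -/
theorem isSigma2_closeStage {α : Type} [Primcodable α] {A : α → ℕ → List (List Bool)}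
    (hA : Primrec₂ A) : IsSigma2 fun z : (α × ℕ) × ℕ => closeStage (A z.1.1) z.1.2 = z.2 := by
  obtain ⟨_, hR⟩ := primrecPred_measure_le
  have ha : Primrec fun z : ((α × ℕ) × ℕ) × ℕ => z.1.1.1 := Primrec.fst.comp (Primrec.fst.comp .fst)
  have hR' := hR.comp ((Primrec.pair (hA.comp ha .snd) (hA.comp ha (Primrec.snd.comp .fst))).pair
    (Primrec.snd.comp (Primrec.fst.comp .fst)))
  have h1 : IsSigma2 fun z : (α × ℕ) × ℕ => IsCloseStage (A z.1.1) z.1.2 z.2 :=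
    .of_forall hR' fun z => by simp [IsCloseStage]
  have h2 : IsSigma2 fun z : (α × ℕ) × ℕ => ¬ IsCloseStage (A z.1.1) z.1.2 z.2 :=
    .of_exists (Primrec.not.comp hR') fun z => by simp [IsCloseStage]
  have h3 : IsSigma2 fun z : ((α × ℕ) × ℕ) × ℕ => ¬ IsCloseStage (A z.1.1.1) z.1.1.2 z.2 :=
    h2.comp (f := fun z : ((α × ℕ) × ℕ) × ℕ => (z.1.1, z.2)) ((Primrec.fst.comp .fst).pair .snd)
  exact (h1.and (h3.forall_lt .snd)).of_eq fun z => closeStage_eq_iff.symm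

/-- The strings whose cylinders are contained in the part of the open set approximated by `A` that
its first `2 ^ (-m)`-close stage misses. -/
def lateStrings (A : ℕ → List (List Bool)) (m : ℕ) : Set (List Bool) :=
  {ρ | ∃ s, closeStage A m = s ∧ (∃ t, ∃ σ ∈ A t, σ <+: ρ) ∧
    ∀ σ ∈ A s, ¬ σ <+: ρ ∧ ¬ ρ <+: σ}

theorem openSet_lateStrings {A : ℕ → List (List Bool)} {S : Set (List Bool)}
    (hS : ∀ ρ, ρ ∈ S ↔ ∃ s, ρ ∈ A s) (m : ℕ) :
    openSet (lateStrings A m) = openSet S \ clopenSet (A (closeStage A m)) := by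
  ext X
  constructor
  · rintro ⟨ρ, ⟨_, rfl, ⟨t, σ, hσ, hp⟩, H⟩, hX⟩
    refine ⟨⟨σ, (hS σ).2 ⟨t, hσ⟩, hX.of_prefix hp⟩, ?_⟩
    rintro ⟨τ, hτ, hX'⟩
    exact (TuringFunctional.isInitial_comparable hX' hX).elim (H τ hτ).1 (H τ hτ).2
  · rintro ⟨⟨σ, hσ, hX⟩, H⟩
    obtain ⟨t, ht⟩ := (hS σ).1 hσ
    -- This length is at least that of `σ` and of every string in the close stage, so comparability
    -- with such a string amounts to extending it.
    set n := σ.length + (A (closeStage A m)).flatten.length with hn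
    refine ⟨firstBits X n, ⟨_, rfl, ⟨t, σ, ht, (isInitial_iff_prefix (by omega)).1 hX⟩,
      fun τ hτ => ?_⟩, isInitial_firstBits X n⟩
    have h1 : ¬ τ <+: firstBits X n := fun h => H ⟨τ, hτ, (isInitial_firstBits X n).of_prefix h⟩
    refine ⟨h1, fun h => h1 ?_⟩
    have : τ.length ≤ n := (length_le_flatten hτ).trans (by omega)
    rw [h.eq_of_length (le_antisymm h.length_le (by simpa using this))]

theorem measure_lateStrings_le {A : ℕ → List (List Bool)} (hA : ∀ s t, s ≤ t → A s ⊆ A t) (m : ℕ) :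
    uniformMeasure (openSet (lateStrings A m)) ≤ (2⁻¹ : ℝ≥0∞) ^ m := by
  have hS : ∀ ρ, ρ ∈ {ρ | ∃ s, ρ ∈ A s} ↔ ∃ s, ρ ∈ A s := fun ρ => Iff.rfl
  rw [openSet_lateStrings hS, measure_sdiff _ (measurableSet_clopenSet _).nullMeasurableSet
    (measure_ne_top _ _), measure_openSet_stages hA hS]
  · exact tsub_le_iff_left.2 (iSup_le (isCloseStage_closeStage A m))
  · rw [clopenSet_stages hS]
    exact Set.subset_iUnion (fun s => clopenSet (A s)) _

theorem isSigma2_lateStrings {α : Type} [Primcodable α] {A : α → ℕ → List (List Bool)}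
    (hA : Primrec₂ A) : IsSigma2 fun z : (α × ℕ) × List Bool => z.2 ∈ lateStrings (A z.1.1) z.1.2 := by
  have h1 : IsSigma2 fun z : ((α × ℕ) × List Bool) × ℕ => closeStage (A z.1.1.1) z.1.1.2 = z.2 :=
    (isSigma2_closeStage hA).comp ((Primrec.fst.comp .fst).pair .snd)
  have ha : Primrec fun z : ((α × ℕ) × List Bool) × ℕ => z.1.1.1 :=
    Primrec.fst.comp (Primrec.fst.comp .fst)
  have h2 : IsSigma2 fun z : ((α × ℕ) × List Bool) × ℕ => ∃ σ ∈ A z.1.1.1 z.2, σ <+: z.1.2 :=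
    PrimrecPred.isSigma2 (primrecRel_exists_prefix.comp (hA.comp ha .snd) (Primrec.snd.comp .fst))
  have h3 : IsSigma2 fun z : ((α × ℕ) × List Bool) × ℕ =>
      ∀ σ ∈ A z.1.1.1 z.2, ¬ σ <+: z.1.2 ∧ ¬ z.1.2 <+: σ := by
    refine IsSigma2.forall_mem (p := fun w : (((α × ℕ) × List Bool) × ℕ) × List Bool =>
      ¬ w.2 <+: w.1.1.2 ∧ ¬ w.1.1.2 <+: w.2) (PrimrecPred.isSigma2 ?_) (hA.comp ha .snd)
    have hρ : Primrec fun w : (((α × ℕ) × List Bool) × ℕ) × List Bool => w.1.1.2 :=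
      Primrec.snd.comp (Primrec.fst.comp .fst)
    exact (primrecRel_prefix.comp .snd hρ).not.and (primrecRel_prefix.comp hρ .snd).not
  exact (h1.and ((h2.exists.comp (f := Prod.fst) .fst).and h3)).exists

theorem tsum_two_inv_pow (k : ℕ) : ∑' e : ℕ, (2⁻¹ : ℝ≥0∞) ^ (k + e + 1) = 2⁻¹ ^ k := by
  have : ∀ e : ℕ, (2⁻¹ : ℝ≥0∞) ^ (k + e + 1) = 2⁻¹ ^ k * 2⁻¹ * 2⁻¹ ^ e := fun e => by ring
  simp only [this, ENNReal.tsum_mul_left, ENNReal.tsum_geometric, ENNReal.one_sub_inv_two, inv_inv]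
  rw [mul_assoc, ENNReal.inv_mul_cancel (by simp) (by simp), mul_one]

/-- All strings that the approximations to the members of a family miss, for a total measure of at
most `2 ^ (-k)`. -/
def familyLateStrings (A : List Bool → ℕ → List (List Bool)) (k : ℕ) : Set (List Bool) :=
  {ρ | ∃ σ, ρ ∈ lateStrings (A σ) (k + encode σ + 1)}

theorem measure_familyLateStrings_le {A : List Bool → ℕ → List (List Bool)}
    (hA : ∀ σ s t, s ≤ t → A σ s ⊆ A σ t) (k : ℕ) :
    uniformMeasure (openSet (familyLateStrings A k)) ≤ (2⁻¹ : ℝ≥0∞) ^ k := by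
  have : familyLateStrings A k = ⋃ σ, lateStrings (A σ) (k + encode σ + 1) := by
    ext ρ
    simp [familyLateStrings]
  rw [this, openSet_iUnion, ← tsum_two_inv_pow k]
  calc _ ≤ ∑' σ : List Bool, uniformMeasure (openSet (lateStrings (A σ) (k + encode σ + 1))) :=
        measure_iUnion_le _
    _ ≤ ∑' σ : List Bool, (2⁻¹ : ℝ≥0∞) ^ (k + encode σ + 1) :=
        ENNReal.tsum_le_tsum fun σ => measure_lateStrings_le (hA σ) _
    _ ≤ _ := ENNReal.tsum_comp_le_tsum_of_injective encode_injective
        fun e => (2⁻¹ : ℝ≥0∞) ^ (k + e + 1)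

theorem isSigma2_familyLateStrings {A : List Bool → ℕ → List (List Bool)} (hA : Primrec₂ A) :
    IsSigma2 fun z : ℕ × List Bool => z.2 ∈ familyLateStrings A z.1 := by
  have h : IsSigma2 fun w : (ℕ × List Bool) × List Bool =>
      w.1.2 ∈ lateStrings (A w.2) (w.1.1 + encode w.2 + 1) := by
    refine (isSigma2_lateStrings hA).comp
      (f := fun w : (ℕ × List Bool) × List Bool => ((w.2, w.1.1 + encode w.2 + 1), w.1.2)) ?_
    exact (Primrec.snd.pair (Primrec.succ.comp (Primrec.nat_add.comp (Primrec.fst.comp .fst)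
      (Primrec.encode.comp .snd)))).pair (Primrec.snd.comp .fst)
  exact h.exists

/-! ### A universal Martin-Löf test relative to the halting problem -/

/-- The `e`-th program halts on the triple `(i, σ, x)`, where `w = (σ, x)`. -/
def HaltsAt (e i : ℕ) (w : List Bool × ℕ) : Prop :=
  ((Denumerable.ofNat Nat.Partrec.Code e).eval (encode (((i, w.1), w.2) : (ℕ × List Bool) × ℕ))).Dom

theorem haltsAt_re : REPred fun z : (ℕ × ℕ) × List Bool × ℕ => HaltsAt z.1.1 z.1.2 z.2 := by
  have h : Primrec fun z : (ℕ × ℕ) × List Bool × ℕ =>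
      encode (((z.1.2, z.2.1), z.2.2) : (ℕ × List Bool) × ℕ) :=
    Primrec.encode.comp (((Primrec.snd.comp .fst).pair (Primrec.fst.comp .snd)).pair
      (Primrec.snd.comp .snd))
  exact Partrec.dom_re (Nat.Partrec.Code.eval_part.comp
    ((Primrec.ofNat _).comp (Primrec.fst.comp .fst)).to_comp h.to_comp)

/-- A witness is good exactly if the search for a refutation diverges. The programs thus enumerate
all `Σ⁰₂` sequences of sets of strings. -/
theorem IsSigma2.exists_index {p : ℕ × List Bool → Prop} (hp : IsSigma2 p) :
    ∃ e, ∀ i σ, p (i, σ) ↔ ∃ x, ¬ HaltsAt e i (σ, x) := by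
  obtain ⟨R, hR, H⟩ := hp
  have hR' : Primrec fun z : ((ℕ × List Bool) × ℕ) × ℕ => !R (z.1.1, z.1.2, z.2) :=
    Primrec.not.comp (hR.comp ((Primrec.fst.comp .fst).pair ((Primrec.snd.comp .fst).pair .snd)))
  obtain ⟨c, hc⟩ := Nat.Partrec.Code.exists_code.1 (rePred_exists hR')
  refine ⟨encode c, fun i σ => (H _).trans (exists_congr fun x => ?_)⟩
  simp only [HaltsAt, Denumerable.ofNat_encode, hc, encodek, Part.coe_some, Part.bind_some]
  simp [Part.assert]

/-- The first `s` candidates for a string together with a witness for its membership. -/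
def candidates (s : ℕ) : List (List Bool × ℕ) :=
  (List.range s).filterMap decode

theorem primrec_candidates : Primrec candidates :=
  Primrec.listFilterMap Primrec.list_range (Primrec.decode.comp .snd)

theorem candidates_mono {s t : ℕ} (h : s ≤ t) : candidates s ⊆ candidates t := by
  intro w hw
  simp only [candidates, List.mem_filterMap, List.mem_range] at hw ⊢
  obtain ⟨j, hj, hw⟩ := hw
  exact ⟨j, hj.trans_le h, hw⟩

theorem mem_candidates (w : List Bool × ℕ) : w ∈ candidates (encode w + 1) := by
  simp only [candidates, List.mem_filterMap, List.mem_range]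
  exact ⟨encode w, Nat.lt_succ_self _, encodek w⟩

/-- The part of the `i`-th member of the `e`-th `Σ⁰₂` sequence of sets that is found among the first
`s` candidates. -/
def stageStrings (e i s : ℕ) : Set (List Bool) :=
  {σ | ∃ w ∈ candidates s, w.1 = σ ∧ ¬ HaltsAt e i w}

theorem stageStrings_mono (e i : ℕ) {s t : ℕ} (h : s ≤ t) :
    stageStrings e i s ⊆ stageStrings e i t :=
  fun _ ⟨w, hw, h'⟩ => ⟨w, candidates_mono h hw, h'⟩

/-- The `e`-th `Σ⁰₂` sequence of sets, with the `i`-th member cut off before its measure exceeds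
`2 ^ (-i)`. -/
def trimmedStrings (e i : ℕ) : Set (List Bool) :=
  {σ | ∃ s, uniformMeasure (openSet (stageStrings e i s)) ≤ (2⁻¹ : ℝ≥0∞) ^ i ∧
    σ ∈ stageStrings e i s}

/-- The stage depends on which programs diverge, so a finite superset `L` of it is guessed instead;
checking the guess requires only halting. The summand for `[]` is zero and gives the inequality the
shape of `primrecPred_measure_le`. -/
theorem measure_stageStrings_le_iff {e i s : ℕ} :
    uniformMeasure (openSet (stageStrings e i s)) ≤ (2⁻¹ : ℝ≥0∞) ^ i ↔
      ∃ L : List (List Bool), (∀ w ∈ candidates s, HaltsAt e i w ∨ w.1 ∈ L) ∧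
        uniformMeasure (clopenSet L) ≤ uniformMeasure (clopenSet []) + (2⁻¹ : ℝ≥0∞) ^ i := by
  classical
  have h0 : uniformMeasure (clopenSet []) = 0 := by
    have : clopenSet [] = ∅ := by
      ext X
      simp [mem_clopenSet]
    rw [this, measure_empty]
  simp only [h0, zero_add]
  constructor
  · intro h
    refine ⟨((candidates s).filter fun w => ¬ HaltsAt e i w).map Prod.fst, fun w hw => ?_,
      (measure_mono (openSet_mono ?_)).trans h⟩
    · by_cases hh : HaltsAt e i w
      · exact .inl hh
      · exact .inr (List.mem_map.2 ⟨w, List.mem_filter.2 ⟨hw, by simpa using hh⟩, rfl⟩)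
    · rintro σ hσ
      obtain ⟨w, hw, rfl⟩ := List.mem_map.1 hσ
      obtain ⟨hw, hh⟩ := List.mem_filter.1 hw
      exact ⟨w, hw, rfl, by simpa using hh⟩
  · rintro ⟨L, hL, h⟩
    refine (measure_mono (openSet_mono ?_)).trans h
    rintro σ ⟨w, hw, rfl, hh⟩
    exact (hL w hw).resolve_left hh

/-- The stages increase, so the union of the admissible ones has the supremum of their measures. -/
theorem measure_trimmedStrings_le (e i : ℕ) :
    uniformMeasure (openSet (trimmedStrings e i)) ≤ (2⁻¹ : ℝ≥0∞) ^ i := by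
  let I := {s // uniformMeasure (openSet (stageStrings e i s)) ≤ (2⁻¹ : ℝ≥0∞) ^ i}
  have h : trimmedStrings e i = ⋃ s : I, stageStrings e i s.1 := by
    ext σ
    simp [trimmedStrings, I]
  rw [h, openSet_iUnion, Directed.measure_iUnion]
  · exact iSup_le fun s => s.2
  · intro s t
    rcases le_total s.1 t.1 with h | h
    · exact ⟨t, openSet_mono (stageStrings_mono e i h), subset_rfl⟩
    · exact ⟨s, subset_rfl, openSet_mono (stageStrings_mono e i h)⟩

theorem isSigma2_trimmedStrings :
    IsSigma2 fun z : (ℕ × ℕ) × List Bool => z.2 ∈ trimmedStrings z.1.1 z.1.2 := by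
  have h1 : IsSigma2 fun w : ((((ℕ × ℕ) × List Bool) × ℕ) × List (List Bool)) × List Bool × ℕ =>
      HaltsAt w.1.1.1.1.1 w.1.1.1.1.2 w.2 ∨ w.2.1 ∈ w.1.2 := by
    refine IsSigma2.or (haltsAt_re.isSigma2.comp
      (f := fun w : ((((ℕ × ℕ) × List Bool) × ℕ) × List (List Bool)) × List Bool × ℕ =>
        (w.1.1.1.1, w.2)) ?_) (PrimrecPred.isSigma2 ?_)
    · exact (Primrec.fst.comp (Primrec.fst.comp (Primrec.fst.comp .fst))).pair .snd
    · refine PrimrecPred.of_eq (Primrec.eq.exists_mem_list.comp (Primrec.snd.comp .fst)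
        (Primrec.fst.comp .snd)) fun w => ?_
      simp
  have h2 : IsSigma2 fun w : (((ℕ × ℕ) × List Bool) × ℕ) × List (List Bool) =>
      uniformMeasure (clopenSet w.2) ≤
        uniformMeasure (clopenSet []) + (2⁻¹ : ℝ≥0∞) ^ w.1.1.1.2 :=
    PrimrecPred.isSigma2 (primrecPred_measure_le.comp
      (f := fun w : (((ℕ × ℕ) × List Bool) × ℕ) × List (List Bool) => ((w.2, []), w.1.1.1.2))
      ((Primrec.snd.pair (.const [])).pair
        (Primrec.snd.comp (Primrec.fst.comp (Primrec.fst.comp .fst)))))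
  have h3 : IsSigma2 fun w : ((ℕ × ℕ) × List Bool) × ℕ =>
      uniformMeasure (openSet (stageStrings w.1.1.1 w.1.1.2 w.2)) ≤ (2⁻¹ : ℝ≥0∞) ^ w.1.1.2 :=
    ((h1.forall_mem (primrec_candidates.comp (Primrec.snd.comp .fst))).and h2).exists.of_eq
      fun w => (measure_stageStrings_le_iff (e := w.1.1.1) (i := w.1.1.2) (s := w.2)).symm
  have h4 : IsSigma2 fun w : (((ℕ × ℕ) × List Bool) × ℕ) × List Bool × ℕ =>
      w.2 ∈ candidates w.1.2 ∧ w.2.1 = w.1.1.2 ∧ ¬ HaltsAt w.1.1.1.1 w.1.1.1.2 w.2 := by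
    refine IsSigma2.and (PrimrecPred.isSigma2 ?_) (IsSigma2.and (PrimrecPred.isSigma2 ?_) ?_)
    · refine PrimrecPred.of_eq (Primrec.eq.exists_mem_list.comp
        (primrec_candidates.comp (Primrec.snd.comp .fst)) .snd) fun w => ?_
      simp
    · exact Primrec.eq.comp (Primrec.fst.comp .snd) (Primrec.snd.comp (Primrec.fst.comp .fst))
    · exact haltsAt_re.isSigma2_not.comp
        (f := fun w : (((ℕ × ℕ) × List Bool) × ℕ) × List Bool × ℕ => (w.1.1.1, w.2))
        ((Primrec.fst.comp (Primrec.fst.comp .fst)).pair .snd)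
  exact (h3.and h4.exists).exists

/-- The members of a universal Martin-Löf test relative to the halting problem. -/
def universalTest (k : ℕ) : Set (List Bool) :=
  {σ | ∃ e, σ ∈ trimmedStrings e (k + e + 1)}

theorem isSigma2_universalTest :
    IsSigma2 fun z : ℕ × List Bool => z.2 ∈ universalTest z.1 := by
  have h : IsSigma2 fun w : (ℕ × List Bool) × ℕ =>
      w.1.2 ∈ trimmedStrings w.2 (w.1.1 + w.2 + 1) :=
    isSigma2_trimmedStrings.comp
      (f := fun w : (ℕ × List Bool) × ℕ => ((w.2, w.1.1 + w.2 + 1), w.1.2))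
      ((Primrec.snd.pair (Primrec.succ.comp (Primrec.nat_add.comp (Primrec.fst.comp .fst)
        .snd))).pair (Primrec.snd.comp .fst))
  exact h.exists

theorem measure_universalTest_le (k : ℕ) :
    uniformMeasure (openSet (universalTest k)) ≤ (2⁻¹ : ℝ≥0∞) ^ k := by
  have : universalTest k = ⋃ e, trimmedStrings e (k + e + 1) := by
    ext σ
    simp [universalTest]
  rw [this, openSet_iUnion, ← tsum_two_inv_pow k]
  exact (measure_iUnion_le _).trans
    (ENNReal.tsum_le_tsum fun e => measure_trimmedStrings_le e _)

/-- A genuine test with index `e` obeys the measure bounds and is never cut off. Its member number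
`k + e + 1` therefore lies inside `universalTest k`. -/
theorem mem_twoRandom_of_notMem_universalTest {X : CantorSeq} {k : ℕ}
    (hX : X ∉ openSet (universalTest k)) : X ∈ twoRandom := by
  rintro U ⟨hU, hm⟩ hXU
  obtain ⟨e, he⟩ := (IsSigma2.of_ceIn hU).exists_index
  refine hX (openSet_mono ?_ (Set.mem_iInter.1 hXU (k + e + 1)))
  intro σ hσ
  obtain ⟨x, hx⟩ := (he _ _).1 hσ
  refine ⟨e, encode (σ, x) + 1, (measure_mono (openSet_mono ?_)).trans (hm _),
    (σ, x), mem_candidates _, rfl, hx⟩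
  rintro τ ⟨w, -, rfl, hw⟩
  exact (he _ _).2 ⟨w.2, hw⟩

/-! ### Outputs of Turing functionals -/

namespace TuringFunctional

variable (Φ : TuringFunctional)

/-- The oracle strings on which the output is seen to extend `σ`. -/
def outputStrings (σ : List Bool) : Set (List Bool) :=
  {ρ | σ = [] ∨ ∃ τ, (ρ, τ) ∈ Φ.graph ∧ σ <+: τ}

theorem openSet_outputStrings (σ : List Bool) :
    openSet (Φ.outputStrings σ) = {X | Φ.OutputExtends X σ} := by
  ext X
  constructor
  · rintro ⟨ρ, rfl | ⟨τ, hg, hp⟩, hX⟩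
    · exact .inl rfl
    · exact .inr ⟨ρ, τ, hg, hX, hp⟩
  · rintro (rfl | ⟨ρ, τ, hg, hX, hp⟩)
    · exact ⟨[], .inl rfl, isInitial_firstBits X 0⟩
    · exact ⟨ρ, .inr ⟨τ, hg, hp⟩, hX⟩

theorem outputStrings_re : REPred fun z : List Bool × List Bool => z.2 ∈ Φ.outputStrings z.1 := by
  obtain ⟨R, hR, H⟩ := exists_primrec_of_rePred Φ.isCE
  have hS : Primrec fun z : (List Bool × List Bool) × ℕ => decide (z.1.1 = []) ||
      ((decode (α := List Bool × ℕ) z.2).map fun w =>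
        R ((z.1.2, w.1), w.2) && decide (z.1.1 <+: w.1)).getD false := by
    refine Primrec.or.comp (Primrec.eq.comp (Primrec.fst.comp .fst) (.const [])).decide
      (Primrec.option_getD.comp (Primrec.option_map (Primrec.decode.comp .snd) ?_) (.const false))
    have h1 : Primrec fun w : ((List Bool × List Bool) × ℕ) × List Bool × ℕ => w.2.1 :=
      Primrec.fst.comp .snd
    have h2 : Primrec fun w : ((List Bool × List Bool) × ℕ) × List Bool × ℕ => w.1.1 :=
      Primrec.fst.comp .fst
    exact Primrec.and.comp
      (hR.comp (((Primrec.snd.comp h2).pair h1).pair (Primrec.snd.comp .snd)))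
      ((PrimrecRel.comp primrecRel_prefix (Primrec.fst.comp h2) h1).decide)
  refine (rePred_exists hS).of_eq ?_
  rintro ⟨σ, ρ⟩
  simp only [Bool.or_eq_true, decide_eq_true_eq]
  constructor
  · rintro ⟨n, h | h⟩
    · exact .inl h
    · cases hd : decode (α := List Bool × ℕ) n with
      | none => simp [hd] at h
      | some w =>
        simp only [hd, Option.map_some, Option.getD_some, Bool.and_eq_true,
          decide_eq_true_eq] at h
        exact .inr ⟨w.1, (H _).2 ⟨_, h.1⟩, h.2⟩
  · rintro (h | ⟨τ, hg, hp⟩)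
    · exact ⟨0, .inl h⟩
    · obtain ⟨n, hn⟩ := (H _).1 hg
      exact ⟨encode (τ, n), .inr (by simp [hn, hp])⟩

variable {Φ}

theorem OutputExtends.of_prefix {X : CantorSeq} {σ τ : List Bool} (h : Φ.OutputExtends X τ)
    (hp : σ <+: τ) : Φ.OutputExtends X σ := by
  rcases h with rfl | ⟨ρ, τ', hg, hX, hp'⟩
  · exact .inl (List.prefix_nil.1 hp)
  · exact .inr ⟨ρ, τ', hg, hX, hp.trans hp'⟩

theorem exists_minimal_prefix {W : Set (List Bool)} {σ : List Bool} (hσ : σ ∈ W) :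
    ∃ τ ∈ W, τ <+: σ ∧ ∀ ρ ∈ W, ρ <+: τ → ρ = τ := by
  induction h : σ.length using Nat.strong_induction_on generalizing σ with
  | _ n ih =>
    by_cases hmin : ∀ ρ ∈ W, ρ <+: σ → ρ = σ
    · exact ⟨σ, hσ, List.prefix_rfl, hmin⟩
    · push Not at hmin
      obtain ⟨ρ, hρ, hp, hne⟩ := hmin
      have hlt : ρ.length < n := by
        rw [← h]
        exact lt_of_le_of_ne hp.length_le fun he => hne (hp.eq_of_length he)
      obtain ⟨τ, hτ, hp', hm⟩ := ih _ hlt hρ rfl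
      exact ⟨τ, hτ, hp'.trans hp, hm⟩

/-- The induced semimeasure of an open set, computed from its minimal strings. -/
theorem measure_exists_outputExtends (Φ : TuringFunctional) (W : Set (List Bool)) :
    uniformMeasure {X | ∃ σ ∈ W, Φ.OutputExtends X σ} =
      ∑' σ : {σ | σ ∈ W ∧ ∀ ρ ∈ W, ρ <+: σ → ρ = σ}, Φ.inducedSemimeasure σ := by
  have h : {X | ∃ σ ∈ W, Φ.OutputExtends X σ} =
      ⋃ σ ∈ {σ | σ ∈ W ∧ ∀ ρ ∈ W, ρ <+: σ → ρ = σ}, {X | Φ.OutputExtends X σ} := by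
    ext X
    simp only [Set.mem_iUnion, Set.mem_ofPred_eq, exists_prop]
    constructor
    · rintro ⟨σ, hσ, hX⟩
      obtain ⟨τ, hτ, hp, hm⟩ := exists_minimal_prefix hσ
      exact ⟨τ, ⟨hτ, hm⟩, hX.of_prefix hp⟩
    · rintro ⟨σ, hσ, hX⟩
      exact ⟨σ, hσ.1, hX⟩
  rw [h, measure_biUnion (Set.to_countable _)]
  · rfl
  -- Two outputs of the same oracle are comparable, so minimality makes them equal.
  · rintro σ ⟨hσ, hσm⟩ τ ⟨hτ, hτm⟩ hne
    rw [Function.onFun, Set.disjoint_left]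
    intro X h1 h2
    rcases Φ.outputExtends_comparable h1 h2 with hp | hp
    · exact hne (hτm σ hσ hp)
    · exact hne (hσm τ hτ hp).symm
  · intro σ _
    rw [← openSet_outputStrings]
    exact measurableSet_openSet _

end TuringFunctional

/-! ### The image of the 2-random sequences -/

/-- A test that covers the sequences that are not 2-random, and also those outputs that the finite
approximations `A` miss. -/
def coverTest (A : List Bool → ℕ → List (List Bool)) (k : ℕ) : Set (List Bool) :=
  universalTest (k + 1) ∪ familyLateStrings A (k + 1)

theorem measure_coverTest_le {A : List Bool → ℕ → List (List Bool)}
    (hA : ∀ σ s t, s ≤ t → A σ s ⊆ A σ t) (k : ℕ) :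
    uniformMeasure (openSet (coverTest A k)) ≤ (2⁻¹ : ℝ≥0∞) ^ k := by
  rw [coverTest, openSet_union]
  refine (measure_union_le _ _).trans ((add_le_add (measure_universalTest_le _)
    (measure_familyLateStrings_le hA _)).trans_eq ?_)
  rw [pow_succ, ← mul_add, ENNReal.inv_two_add_inv_two, mul_one]

theorem isSigma2_coverTest {A : List Bool → ℕ → List (List Bool)} (hA : Primrec₂ A) :
    IsSigma2 fun z : ℕ × List Bool => z.2 ∈ coverTest A z.1 := by
  have hf : Primrec fun z : ℕ × List Bool => (z.1 + 1, z.2) :=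
    (Primrec.succ.comp .fst).pair .snd
  have h1 : IsSigma2 fun z : ℕ × List Bool => z.2 ∈ universalTest (z.1 + 1) :=
    isSigma2_universalTest.comp (f := fun z : ℕ × List Bool => (z.1 + 1, z.2)) hf
  have h2 : IsSigma2 fun z : ℕ × List Bool => z.2 ∈ familyLateStrings A (z.1 + 1) :=
    (isSigma2_familyLateStrings hA).comp (f := fun z : ℕ × List Bool => (z.1 + 1, z.2)) hf
  exact (h1.or h2).of_eq fun z => Iff.rfl

/-- The strings whose close approximation from `A` is covered by the test. -/
def coveredOutputs (A : List Bool → ℕ → List (List Bool)) (k : ℕ) : Set (List Bool) :=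
  {σ | clopenSet (A σ (closeStage (A σ) (k + 1 + encode σ + 1))) ⊆ openSet (coverTest A k)}

/-- Guess the close stage `s` and a finite `M` inside the cover; that the cylinders of `M` contain
the approximation is decidable. -/
theorem isSigma2_coveredOutputs {A : List Bool → ℕ → List (List Bool)} (hA : Primrec₂ A) :
    IsSigma2 fun z : ℕ × List Bool => z.2 ∈ coveredOutputs A z.1 := by
  have h1 : IsSigma2 fun w : (ℕ × List Bool) × ℕ =>
      closeStage (A w.1.2) (w.1.1 + 1 + encode w.1.2 + 1) = w.2 :=
    (isSigma2_closeStage hA).comp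
      (f := fun w : (ℕ × List Bool) × ℕ => ((w.1.2, w.1.1 + 1 + encode w.1.2 + 1), w.2))
      (((Primrec.snd.comp .fst).pair (Primrec.succ.comp (Primrec.nat_add.comp
        (Primrec.succ.comp (Primrec.fst.comp .fst))
        (Primrec.encode.comp (Primrec.snd.comp .fst))))).pair .snd)
  have h2 : IsSigma2 fun w : (((ℕ × List Bool) × ℕ) × List (List Bool)) × List Bool =>
      w.2 ∈ coverTest A w.1.1.1.1 :=
    (isSigma2_coverTest hA).comp
      ((Primrec.fst.comp (Primrec.fst.comp (Primrec.fst.comp .fst))).pair .snd)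
  have h3 : IsSigma2 fun w : ((ℕ × List Bool) × ℕ) × List (List Bool) =>
      clopenSet (A w.1.1.2 w.1.2) ⊆ clopenSet w.2 :=
    PrimrecPred.isSigma2 (primrecPred_clopenSet_subset.comp
      ((hA.comp (Primrec.snd.comp (Primrec.fst.comp .fst)) (Primrec.snd.comp .fst)).pair .snd))
  refine (h1.and ((h2.forall_mem .snd).and h3).exists).exists.of_eq fun z => ?_
  constructor
  · rintro ⟨s, hs, M, hM, h⟩
    have hs' : closeStage (A z.2) (z.1 + 1 + encode z.2 + 1) = s := hs
    subst hs'
    exact h.trans (openSet_mono hM)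
  · intro h
    obtain ⟨M, hM, h⟩ := exists_list_cover h
    exact ⟨_, rfl, M, hM, h⟩

theorem image_twoRandom_subset {Φ Ψ : TuringFunctional}
    (h : Φ.inducedSemimeasure = Ψ.inducedSemimeasure) :
    Φ.toPFun.image twoRandom ⊆ Ψ.toPFun.image twoRandom := by
  rintro Y ⟨X, hX, hXY⟩
  have hY := (Φ.mem_toPFun_iff X Y).1 hXY
  obtain ⟨A, hA, hmono, hAΨ⟩ := exists_primrec_approx Ψ.outputStrings_re
  have hlim : ∀ σ ρ, ρ ∈ Ψ.outputStrings σ ↔ ∃ s, ρ ∈ A σ s := hAΨ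
  let C : ℕ → List Bool → Set CantorSeq := fun k σ =>
    clopenSet (A σ (closeStage (A σ) (k + 1 + encode σ + 1)))
  have hCsub : ∀ k σ, C k σ ⊆ {X | Ψ.OutputExtends X σ} := fun k σ => by
    rw [← Ψ.openSet_outputStrings, clopenSet_stages (hlim σ)]
    exact Set.subset_iUnion (fun s => clopenSet (A σ s)) _
  -- The precision of `C k σ` is the one that `familyLateStrings A (k + 1)` assigns to `σ`, so
  -- whatever `C k σ` misses belongs to the cover.
  have hsubC : ∀ k σ Z, Ψ.OutputExtends Z σ → Z ∉ openSet (coverTest A k) → Z ∈ C k σ := by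
    intro k σ Z hZ hc
    by_contra hC
    have : Z ∈ openSet (lateStrings (A σ) (k + 1 + encode σ + 1)) := by
      rw [openSet_lateStrings (hlim σ), Ψ.openSet_outputStrings]
      exact ⟨hZ, hC⟩
    exact hc (openSet_mono (fun ρ hρ => .inr ⟨σ, hρ⟩) this)
  let T : ℕ → Set (List Bool) := fun k => {ρ | ∃ σ, σ ∈ coveredOutputs A k ∧ ρ ∈ Φ.outputStrings σ}
  have hT : ∀ k, openSet (T k) = {X | ∃ σ ∈ coveredOutputs A k, Φ.OutputExtends X σ} := by
    intro k
    have : T k = ⋃ σ : coveredOutputs A k, Φ.outputStrings σ := by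
      ext ρ
      simp [T]
    rw [this, openSet_iUnion]
    ext Z
    simp [TuringFunctional.openSet_outputStrings]
  have htest : IsMartinLofTest haltingOracle T := by
    constructor
    · refine IsSigma2.ceIn ?_
      have h1 : IsSigma2 fun w : (ℕ × List Bool) × List Bool => w.2 ∈ coveredOutputs A w.1.1 :=
        (isSigma2_coveredOutputs hA).comp ((Primrec.fst.comp .fst).pair .snd)
      have h2 : IsSigma2 fun w : (ℕ × List Bool) × List Bool => w.1.2 ∈ Φ.outputStrings w.2 :=
        Φ.outputStrings_re.isSigma2.comp
          (f := fun w : (ℕ × List Bool) × List Bool => (w.2, w.1.2))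
          (Primrec.snd.pair (Primrec.snd.comp .fst))
      exact (h1.and h2).exists
    · intro k
      -- Here the hypothesis enters: both preimages have the same sum over minimal strings as their
      -- measure, and the one under `Ψ` lies in the cover.
      rw [hT, TuringFunctional.measure_exists_outputExtends, h,
        ← TuringFunctional.measure_exists_outputExtends]
      refine (measure_mono ?_).trans (measure_coverTest_le hmono k)
      rintro Z ⟨σ, hσ, hZ⟩
      by_contra hc
      exact hc (hσ (hsubC k σ Z hZ hc))
  have hXT := hX T htest
  simp only [Set.mem_iInter, not_forall, hT] at hXT
  obtain ⟨k, hk⟩ := hXT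
  have hne : ∀ n, (C k (firstBits Y n) \ openSet (coverTest A k)).Nonempty := fun n =>
    Set.sdiff_nonempty.2 fun hsub => hk ⟨firstBits Y n, hsub, hY n⟩
  have hclosed : ∀ n, IsClosed (C k (firstBits Y n) \ openSet (coverTest A k)) := fun n =>
    (isClosed_clopenSet _).sdiff (isOpen_openSet _)
  -- The sets `C k` need not decrease along `Y`. Off the cover they agree with the preimages under
  -- `Ψ`, which do.
  obtain ⟨Z, hZ⟩ := IsCompact.nonempty_iInter_of_sequence_nonempty_isCompact_isClosed
    (fun n => C k (firstBits Y n) \ openSet (coverTest A k))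
    (fun n Z hZ => ⟨hsubC k _ Z ((hCsub k _ hZ.1).of_prefix (firstBits_prefix Y n.le_succ)) hZ.2,
      hZ.2⟩) hne (hclosed 0).isCompact hclosed
  rw [Set.mem_iInter] at hZ
  refine ⟨Z, ?_, (Ψ.mem_toPFun_iff Z Y).2 fun n => hCsub k _ (hZ n).1⟩
  exact mem_twoRandom_of_notMem_universalTest fun hV =>
    (hZ 0).2 (openSet_mono Set.subset_union_left hV)

end Shen

theorem mainTheorem5 (Φ Ψ : Shen.TuringFunctional)
    (h : Φ.inducedSemimeasure = Ψ.inducedSemimeasure) :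
    Φ.toPFun.image Shen.twoRandom = Ψ.toPFun.image Shen.twoRandom :=
  (Shen.image_twoRandom_subset h).antisymm (Shen.image_twoRandom_subset h.symm)
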